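/- Let $\mathbb D$ be the open unit disk of $\mathbb C$ and $\mathbb T$ its boundary. Let $\omega\neq 0$ be a modulus of continuity, i.e. a nonnegative, nondecreasing, continuous function on $[0,2]$ with $\omega(0)=0$ and $t\mapsto \omega(t)/t$ nonincreasing on $(0,2]$, and suppose that $$\eta_\omega:=\inf_{0<t\le 1}\frac{\omega(t^2)}{\omega(t)}>0 .$$ Let $Lip_\omega$ be the algebra of all functions $f$ that are continuous on $\overline{\mathbb D}$, analytic in $\mathbb D$, and satisfy $\sup_{\xi,\zeta\in\mathbb T,\ \xi\ne\zeta}\frac{|f(\xi)-f(\zeta)|}{\omega(|\xi-\zeta|)}<+\infty$, with the norm $$\|f\|_\omega:=\sup_{z\in\mathbb D}|f(z)|+\sup_{\xi,\zeta\in\mathbb T,\ \xi\ne\zeta}\frac{|f(\xi)-f(\zeta)|}{\omega(|\xi-\zeta|)} .$$ Let $\mathcal I\subseteq Lip_\omega$ be an ideal that is closed for $\|\cdot\|_\omega$, and let $\mathbb E_{\mathcal I}:=\{\xi\in\mathbb T: f(\xi)=0\ \text{for all } f\in\mathcal I\}$. For closed $\mathbb E\subseteq\mathbb T$ and $\delta>0$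 put $\mathbb E(\delta):=\{\xi\in\mathbb T: d(\xi,\mathbb E)\le\delta\}$, where $d$ is the Euclidean distance (with $d(\xi,\emptyset)=\infty$), and let $\mathcal J_\omega(\mathbb E)$ be the set of all $f\in Lip_\omega$ with $f|_{\mathbb E}\equiv 0$ and $$\lim_{\delta\to 0}\ \sup_{\xi,\zeta\in\mathbb E(\delta),\ \xi\ne\zeta}\frac{|f(\xi)-f(\zeta)|}{\omega(|\xi-\zeta|)}=0$$ (a supremum over the empty set being $0$). Let $g\in\mathcal J_\omega(\mathbb E_{\mathcal I})$. Suppose that $gf\in\mathcal I$ for some outer function $f\in Lip_\omega$, that is, a function $f \in Lip_\omega$ such that $\log|f|$ is integrable on $\mathbb T$ and, for some constant $c$ with $|c|=1$, $$f(z)=c\,\exp\Big\{\frac1{2\pi}\int_{\mathbb T}\frac{\xi+z}{\xi-z}\log|f(\xi)|\,|d\xi|\Big\},\qquad z\in\mathbb D .$$ Then $g\in\mathcal I$. -/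

import Mathlib

open Metric Set

/-- A modulus of continuity: a nonnegative nondecreasing continuous function `ω ≠ 0` on `[0, 2]`
with `ω 0 = 0` and `t ↦ ω t / t` nonincreasing. (Values outside `[0, 2]` play no role.) -/
structure ModulusOfContinuity where
  toFun : ℝ → ℝ
  nonneg' : ∀ t ∈ Icc (0 : ℝ) 2, 0 ≤ toFun t
  monotoneOn' : MonotoneOn toFun (Icc 0 2)
  continuousOn' : ContinuousOn toFun (Icc 0 2)
  zero' : toFun 0 = 0
  antitoneOn' : AntitoneOn (fun t => toFun t / t) (Ioc 0 2)
  ne_zero' : ∃ t ∈ Icc (0 : ℝ) 2, toFun t ≠ 0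

instance : CoeFun ModulusOfContinuity (fun _ => ℝ → ℝ) := ⟨ModulusOfContinuity.toFun⟩

/-- The constant `η_ω = inf_{0 < t ≤ 1} ω(t²) / ω(t)`. -/
noncomputable def ModulusOfContinuity.eta (ω : ModulusOfContinuity) : ℝ :=
  sInf ((fun t : ℝ => ω (t ^ 2) / ω t) '' Ioc 0 1)

/-- The closed unit disc. -/
abbrev ClosedDisc : Type := closedBall (0 : ℂ) 1

/-- A function on the closed unit disc, extended by `0` to all of `ℂ`. -/
noncomputable def discExt (f : ClosedDisc → ℂ) (z : ℂ) : ℂ :=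
  open Classical in if h : z ∈ closedBall (0 : ℂ) 1 then f ⟨z, h⟩ else 0

theorem discExt_of_mem (f : ClosedDisc → ℂ) {z : ℂ} (h : z ∈ closedBall (0 : ℂ) 1) :
    discExt f z = f ⟨z, h⟩ := by
  simp only [discExt, dif_pos h]

theorem discExt_add (f g : C(ClosedDisc, ℂ)) :
    discExt ⇑(f + g) = discExt f + discExt g := by
  funext z
  by_cases h : z ∈ closedBall (0 : ℂ) 1 <;> simp only [discExt, h, Pi.add_apply] <;> simp

theorem discExt_mul (f g : C(ClosedDisc, ℂ)) :
    discExt ⇑(f * g) = discExt f * discExt g := by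
  funext z
  by_cases h : z ∈ closedBall (0 : ℂ) 1 <;> simp only [discExt, h, Pi.mul_apply] <;> simp

/-- The disc algebra `𝒜(𝔻)`: continuous functions on the closed unit disc that are analytic in
the open unit disc. -/
noncomputable def DiscAlgebra : Subalgebra ℂ C(ClosedDisc, ℂ) where
  carrier := {f | DifferentiableOn ℂ (discExt f) (ball 0 1)}
  mul_mem' := by
    intro f g hf hg
    simp only [mem_ofPred_eq, discExt_mul] at *
    exact hf.mul hg
  add_mem' := by
    intro f g hf hg
    simp only [mem_ofPred_eq, discExt_add] at *
    exact hf.add hg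
  algebraMap_mem' := by
    intro c
    refine (differentiableOn_const c).congr fun z hz => ?_
    rw [discExt_of_mem _ (ball_subset_closedBall hz)]
    rfl

/-- The set of difference quotients `|f ξ - f ζ| / ω |ξ - ζ|` over distinct points `ξ, ζ` of a
set `S`. -/
def lipQuotients (ω : ModulusOfContinuity) (f : ℂ → ℂ) (S : Set ℂ) : Set ℝ :=
  {r | ∃ ξ ∈ S, ∃ ζ ∈ S, ξ ≠ ζ ∧ r = ‖f ξ - f ζ‖ / ω ‖ξ - ζ‖}

theorem discExt_bounded (f : C(ClosedDisc, ℂ)) : ∃ M : ℝ, 0 ≤ M ∧ ∀ z, ‖discExt f z‖ ≤ M := by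
  have hc : CompactSpace ClosedDisc := isCompact_iff_compactSpace.mp (isCompact_closedBall 0 1)
  refine ⟨‖f‖, norm_nonneg _, fun z => ?_⟩
  by_cases h : z ∈ closedBall (0 : ℂ) 1
  · rw [discExt_of_mem _ h]; exact f.norm_coe_le_norm _
  · simp only [discExt, dif_neg h, norm_zero]; exact norm_nonneg _

theorem ModulusOfContinuity.nonneg_sphere (ω : ModulusOfContinuity) {ξ ζ : ℂ}
    (hξ : ξ ∈ sphere (0 : ℂ) 1) (hζ : ζ ∈ sphere (0 : ℂ) 1) : 0 ≤ ω ‖ξ - ζ‖ := by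
  rw [mem_sphere_zero_iff_norm] at hξ hζ
  refine ω.nonneg' _ ⟨norm_nonneg _, (norm_sub_le _ _).trans ?_⟩
  rw [hξ, hζ]; norm_num

/-- The weighted big Lipschitz algebra `Lip_ω = Lip_ω(𝕋)`: the functions of the disc algebra with
`sup_{ξ ≠ ζ ∈ 𝕋} |f ξ - f ζ| / ω |ξ - ζ| < ∞`. -/
noncomputable def LipAlgebra (ω : ModulusOfContinuity) : Subalgebra ℂ C(ClosedDisc, ℂ) where
  carrier := {f | f ∈ DiscAlgebra ∧ BddAbove (lipQuotients ω (discExt f) (sphere 0 1))}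
  mul_mem' := by
    rintro f g ⟨hf, A, hA⟩ ⟨hg, B, hB⟩
    refine ⟨mul_mem hf hg, ?_⟩
    obtain ⟨M, hM0, hM⟩ := discExt_bounded f
    obtain ⟨N, hN0, hN⟩ := discExt_bounded g
    refine ⟨M * B + N * A, ?_⟩
    rintro r ⟨ξ, hξ, ζ, hζ, hne, rfl⟩
    have h1 := hA ⟨ξ, hξ, ζ, hζ, hne, rfl⟩
    have h2 := hB ⟨ξ, hξ, ζ, hζ, hne, rfl⟩
    have hω := ω.nonneg_sphere hξ hζ
    have key : ‖discExt (⇑(f * g)) ξ - discExt (⇑(f * g)) ζ‖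
        ≤ M * ‖discExt g ξ - discExt g ζ‖ + N * ‖discExt f ξ - discExt f ζ‖ := by
      rw [discExt_mul]
      have : (discExt f * discExt g) ξ - (discExt f * discExt g) ζ
          = discExt f ξ * (discExt g ξ - discExt g ζ)
            + discExt g ζ * (discExt f ξ - discExt f ζ) := by
        simp only [Pi.mul_apply]; ring
      rw [this]
      refine (norm_add_le _ _).trans ?_
      rw [norm_mul, norm_mul]
      gcongr
      · exact hM ξ
      · exact hN ζ
    calc _ ≤ (M * ‖discExt g ξ - discExt g ζ‖ + N * ‖discExt f ξ - discExt f ζ‖)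
            / ω ‖ξ - ζ‖ := by gcongr
      _ = M * (‖discExt g ξ - discExt g ζ‖ / ω ‖ξ - ζ‖)
            + N * (‖discExt f ξ - discExt f ζ‖ / ω ‖ξ - ζ‖) := by ring
      _ ≤ _ := by gcongr
  add_mem' := by
    rintro f g ⟨hf, A, hA⟩ ⟨hg, B, hB⟩
    refine ⟨add_mem hf hg, A + B, ?_⟩
    rintro r ⟨ξ, hξ, ζ, hζ, hne, rfl⟩
    have h1 := hA ⟨ξ, hξ, ζ, hζ, hne, rfl⟩
    have h2 := hB ⟨ξ, hξ, ζ, hζ, hne, rfl⟩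
    have hω := ω.nonneg_sphere hξ hζ
    have key : ‖discExt (⇑(f + g)) ξ - discExt (⇑(f + g)) ζ‖
        ≤ ‖discExt f ξ - discExt f ζ‖ + ‖discExt g ξ - discExt g ζ‖ := by
      rw [discExt_add, Pi.add_apply, Pi.add_apply, add_sub_add_comm]
      exact norm_add_le _ _
    calc _ ≤ (‖discExt f ξ - discExt f ζ‖ + ‖discExt g ξ - discExt g ζ‖)
            / ω ‖ξ - ζ‖ := by gcongr
      _ = ‖discExt f ξ - discExt f ζ‖ / ω ‖ξ - ζ‖
            + ‖discExt g ξ - discExt g ζ‖ / ω ‖ξ - ζ‖ := by ring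
      _ ≤ _ := add_le_add h1 h2
  algebraMap_mem' := by
    intro c
    refine ⟨algebraMap_mem DiscAlgebra c, 0, ?_⟩
    rintro r ⟨ξ, hξ, ζ, hζ, hne, rfl⟩
    rw [discExt_of_mem _ (sphere_subset_closedBall hξ),
      discExt_of_mem _ (sphere_subset_closedBall hζ)]
    simp

/-- A function of `Lip_ω` as a function on `ℂ` (its genuine values on the closed unit disc). -/
noncomputable def lipFun {ω : ModulusOfContinuity} (f : LipAlgebra ω) : ℂ → ℂ :=
  discExt f.1

/-- The norm `‖f‖_ω = sup_{z ∈ 𝔻} |f z| + sup_{ξ ≠ ζ ∈ 𝕋} |f ξ - f ζ| / ω |ξ - ζ|` of `Lip_ω`.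
(The type `LipAlgebra ω` inherits the mere supremum norm from Mathlib; that one is not used.) -/
noncomputable def LipAlgebra.lipNorm {ω : ModulusOfContinuity} (f : LipAlgebra ω) : ℝ :=
  sSup ((fun z => ‖lipFun f z‖) '' ball (0 : ℂ) 1) + sSup (lipQuotients ω (lipFun f) (sphere 0 1))

/-- The ideal `I` of `Lip_ω` is closed with respect to the norm `‖·‖_ω`: it contains every `h`
that is approximated in this norm by elements of `I`. -/
def LipAlgebra.IsNormClosed {ω : ModulusOfContinuity} (I : Ideal (LipAlgebra ω)) : Prop :=
  ∀ h : LipAlgebra ω, (∀ ε : ℝ, 0 < ε → ∃ k ∈ I, LipAlgebra.lipNorm (h - k) < ε) → h ∈ I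

/-- The hull `E_I = {ξ ∈ 𝕋 : f ξ = 0 for all f ∈ I}`. -/
def LipAlgebra.hull {ω : ModulusOfContinuity} (I : Ideal (LipAlgebra ω)) : Set ℂ :=
  {ξ | ξ ∈ sphere (0 : ℂ) 1 ∧ ∀ f ∈ I, lipFun f ξ = 0}

/-- `E(δ) = {ξ ∈ 𝕋 : d(ξ, E) ≤ δ}`; the distance to the empty set is `∞`. -/
def circleNhd (E : Set ℂ) (δ : ℝ) : Set ℂ := sphere (0 : ℂ) 1 ∩ cthickening δ E

/-- The space `J_ω(E)`: the functions `f ∈ Lip_ω` that vanish on `E` and satisfy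
`lim_{δ → 0} sup_{ξ ≠ ζ ∈ E(δ)} |f ξ - f ζ| / ω |ξ - ζ| = 0`. -/
def LipAlgebra.smallSpace (ω : ModulusOfContinuity) (E : Set ℂ) : Set (LipAlgebra ω) :=
  {f | (∀ ξ ∈ E, lipFun f ξ = 0) ∧
    ∀ ε : ℝ, 0 < ε → ∃ δ : ℝ, 0 < δ ∧ ∀ r ∈ lipQuotients ω (lipFun f) (circleNhd E δ), r ≤ ε}

/-- `f` is an outer function: `log |f|` is integrable on the unit circle and, for some unimodular
constant `c`,
`f z = c * exp ((1 / 2π) ∫_𝕋 ((ξ + z) / (ξ - z)) log |f ξ| |dξ|)` in the open unit disc.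
(In particular `f` is not the zero function.) -/
def LipAlgebra.IsOuter {ω : ModulusOfContinuity} (f : LipAlgebra ω) : Prop :=
  CircleIntegrable (fun ξ => Real.log ‖lipFun f ξ‖) 0 1 ∧
    ∃ c : ℂ, ‖c‖ = 1 ∧ ∀ z ∈ ball (0 : ℂ) 1,
      lipFun f z = c * Complex.exp
        (Real.circleAverage (fun ξ => (ξ + z) / (ξ - z) * (Real.log ‖lipFun f ξ‖ : ℂ)) 0 1)

/-! Let `K` be the ideal of all `h` with `g * h ∈ I`. It contains `f` and `I`, so its common zeros
in the closed disc lie in the hull `E` (an outer function has no zeros inside). If `E` is empty, `K`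
is the whole algebra; if `E` has positive arc length, `g = 0`. In the remaining case it suffices to
find `V n ∈ K` with `g * V n → g` in `‖·‖_ω`.

To build them, scale so that `|f| ≤ 1` and write `f = c * herglotzExp ν` with `ν ≥ 0` absolutely
continuous. Cut the circle into `M` arcs, let `Γ` be the union of those near `E` and `Γ'` that of
the others, and split `ν` accordingly; thus `f` becomes a product of a factor singular at most on
`Γ` and one singular at most on `Γ'`. Multiplying each factor by the square of a function vanishing
on the finite set `Γ ∩ Γ'` puts both into `Lip_ω` (`norm_dampedFactor_sub_le`). The product of the
two damped factors lies in `K`, and the one for `Γ'` has no zero on `E`. Since every maximal ideal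
is an evaluation at a point of the closed disc (`exists_forall_mem_lipFun_eq_zero`), that factor can
be cancelled modulo `K`, and the factor for `Γ` is the required `V`
(`exists_mem_lipFun_eq_dampedFactor`).

As `M → ∞`, `ν Γ → ν E = 0`, so `V → 1` uniformly away from `E`. Near `E` the Lipschitz quotients of
`V` may blow up, but with a bound `t / d ^ 8`, where `t = |ξ - ζ|` and `d` is the distance of `ξ` to
`E`, whose constant does not depend on `M` (`exists_mem_approximate_unit`). Because `η_ω > 0`, `ω d`
is comparable to `ω (d ^ 8)`, so multiplying by `ω d` turns this into a bound by `ω t`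
(`mul_le_of_le_two`). Membership of `g` in the small space gives `|g ξ| ≤ τ ω d` near `E`, which
supplies that weight together with a small factor (`mem_of_approximate_unit`). -/

/-! ### Inequalities for the modulus of continuity. -/

namespace ModulusOfContinuity

variable (ω : ModulusOfContinuity)

/-- A zero at `t > 0` would spread to the left because `ω` is nondecreasing and to the right because
`ω s / s` is nonincreasing, contradicting `ω ≠ 0`. -/
theorem pos {t : ℝ} (h0 : 0 < t) (h2 : t ≤ 2) : 0 < ω t := by
  refine lt_of_le_of_ne (ω.nonneg' t ⟨h0.le, h2⟩) fun h => ?_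
  obtain ⟨s, hs, hne⟩ := ω.ne_zero'
  apply hne
  have hs0 : 0 ≤ ω s := ω.nonneg' s hs
  rcases le_total s t with hst | hst
  · have := ω.monotoneOn' hs ⟨h0.le, h2⟩ hst
    exact le_antisymm (this.trans h.symm.le) hs0
  · have hs' : 0 < s := h0.trans_le hst
    have := ω.antitoneOn' ⟨h0, h2⟩ ⟨hs', hs.2⟩ hst
    simp only at this
    rw [← h, zero_div, div_le_iff₀ hs', zero_mul] at this
    exact le_antisymm this hs0

theorem div_le_div {s t : ℝ} (hs : 0 < s) (hst : s ≤ t) (ht : t ≤ 2) : ω t / t ≤ ω s / s :=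
  ω.antitoneOn' ⟨hs, hst.trans ht⟩ ⟨hs.trans_le hst, ht⟩ hst

theorem le_of_le {s t : ℝ} (hs : 0 ≤ s) (hst : s ≤ t) (ht : t ≤ 2) : ω s ≤ ω t :=
  ω.monotoneOn' ⟨hs, hst.trans ht⟩ ⟨hs.trans hst, ht⟩ hst

/-- This is what turns ordinary Lipschitz bounds into bounds by `ω`. -/
theorem mul_le {t : ℝ} (h0 : 0 ≤ t) (h2 : t ≤ 2) : ω 2 / 2 * t ≤ ω t := by
  rcases h0.eq_or_lt with rfl | h0
  · simp [ω.zero']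
  · have := ω.div_le_div h0 h2 le_rfl
    rwa [le_div_iff₀ h0] at this

theorem le_two_mul_half {t : ℝ} (h0 : 0 ≤ t) (h2 : t ≤ 2) : ω t ≤ 2 * ω (t / 2) := by
  rcases h0.eq_or_lt with rfl | h0
  · simp [ω.zero']
  · have := ω.div_le_div (half_pos h0) (half_le_self h0.le) h2
    rw [div_le_div_iff₀ h0 (half_pos h0)] at this
    nlinarith

theorem eta_mul_le {t : ℝ} (h0 : 0 < t) (h1 : t ≤ 1) : ω.eta * ω t ≤ ω (t ^ 2) := by
  -- The real `sInf` is a lower bound only for sets that are bounded below.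
  have hbdd : BddBelow ((fun t : ℝ => ω (t ^ 2) / ω t) '' Ioc 0 1) := by
    refine ⟨0, ?_⟩
    rintro _ ⟨s, hs, rfl⟩
    have h1 : 0 < ω s := ω.pos hs.1 (by linarith [hs.2])
    have h2 : 0 < ω (s ^ 2) := ω.pos (pow_pos hs.1 2) (by nlinarith [hs.1, hs.2])
    positivity
  have := csInf_le hbdd ⟨t, ⟨h0, h1⟩, rfl⟩
  exact (le_div_iff₀ (ω.pos h0 (by linarith))).1 this

/-- Three squarings, `t → t ^ 2 → t ^ 4 → t ^ 8`. The later estimates lose a sixth power of the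
distance to `E`, which is rounded up to this eighth power. -/
theorem eta_pow_three_mul_le (hω : 0 < ω.eta) {t : ℝ} (h0 : 0 < t) (h1 : t ≤ 1) :
    ω.eta ^ 3 * ω t ≤ ω (t ^ 8) := by
  have a1 := ω.eta_mul_le h0 h1
  have a2 := ω.eta_mul_le (pow_pos h0 2) (pow_le_one₀ h0.le h1)
  have a3 := ω.eta_mul_le (pow_pos (pow_pos h0 2) 2)
    (pow_le_one₀ (by positivity) (pow_le_one₀ h0.le h1))
  rw [← pow_mul] at a2
  rw [← pow_mul, ← pow_mul] at a3
  norm_num at a2 a3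
  calc ω.eta ^ 3 * ω t = ω.eta * (ω.eta * (ω.eta * ω t)) := by ring
    _ ≤ ω.eta * (ω.eta * ω (t ^ 2)) := by gcongr
    _ ≤ ω.eta * ω (t ^ 4) := by gcongr
    _ ≤ _ := a3

end ModulusOfContinuity

theorem norm_sub_le_two_of_sphere {ξ ζ : ℂ} (hξ : ξ ∈ sphere (0 : ℂ) 1)
    (hζ : ζ ∈ sphere (0 : ℂ) 1) : ‖ξ - ζ‖ ≤ 2 := by
  rw [mem_sphere_zero_iff_norm] at hξ hζ
  linarith [norm_sub_le ξ ζ]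

instance : CompactSpace ClosedDisc := isCompact_iff_compactSpace.mp (isCompact_closedBall 0 1)

theorem continuousOn_discExt (f : C(ClosedDisc, ℂ)) :
    ContinuousOn (discExt f) (closedBall 0 1) := by
  rw [continuousOn_iff_continuous_domRestrict]
  have : (closedBall (0 : ℂ) 1).domRestrict (discExt f) = f := by
    funext z
    exact discExt_of_mem _ z.2
  rw [this]
  exact f.continuous

/-! ### The supremum norm and the Lipschitz seminorm of `Lip_ω`. -/

namespace LipAlgebra

variable {ω : ModulusOfContinuity}

theorem lipFun_add (f g : LipAlgebra ω) (z : ℂ) : lipFun (f + g) z = lipFun f z + lipFun g z :=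
  congrFun (discExt_add f.1 g.1) z

theorem lipFun_mul (f g : LipAlgebra ω) (z : ℂ) : lipFun (f * g) z = lipFun f z * lipFun g z :=
  congrFun (discExt_mul f.1 g.1) z

theorem lipFun_algebraMap (c : ℂ) {z : ℂ} (hz : z ∈ closedBall (0 : ℂ) 1) :
    lipFun (algebraMap ℂ (LipAlgebra ω) c) z = c :=
  discExt_of_mem _ hz

theorem lipFun_one {z : ℂ} (hz : z ∈ closedBall (0 : ℂ) 1) :
    lipFun (1 : LipAlgebra ω) z = 1 :=
  discExt_of_mem _ hz

theorem lipFun_zero (z : ℂ) : lipFun (0 : LipAlgebra ω) z = 0 := by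
  have := lipFun_add (0 : LipAlgebra ω) 0 z
  rw [add_zero] at this
  simpa using this

theorem lipFun_neg (f : LipAlgebra ω) (z : ℂ) : lipFun (-f) z = -lipFun f z := by
  have := lipFun_add (-f) f z
  rw [neg_add_cancel, lipFun_zero] at this
  exact eq_neg_of_add_eq_zero_left this.symm

theorem lipFun_sub (f g : LipAlgebra ω) (z : ℂ) : lipFun (f - g) z = lipFun f z - lipFun g z := by
  rw [sub_eq_add_neg, lipFun_add, lipFun_neg, sub_eq_add_neg]

theorem ext_lipFun {f g : LipAlgebra ω} (h : ∀ z ∈ closedBall (0 : ℂ) 1, lipFun f z = lipFun g z) :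
    f = g := by
  refine Subtype.ext (ContinuousMap.ext fun z => ?_)
  have := h z z.2
  rwa [lipFun, lipFun, discExt_of_mem _ z.2, discExt_of_mem _ z.2] at this

theorem continuousOn_lipFun (f : LipAlgebra ω) : ContinuousOn (lipFun f) (closedBall 0 1) :=
  continuousOn_discExt f.1

theorem differentiableOn_lipFun (f : LipAlgebra ω) : DifferentiableOn ℂ (lipFun f) (ball 0 1) :=
  f.2.1

theorem diffContOnCl_lipFun (f : LipAlgebra ω) : DiffContOnCl ℂ (lipFun f) (ball 0 1) :=
  ⟨differentiableOn_lipFun f, by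
    rw [closure_ball _ one_ne_zero]; exact continuousOn_lipFun f⟩

/-- The supremum of `|f|` over the open disc. -/
noncomputable def supNorm (f : LipAlgebra ω) : ℝ := sSup ((fun z => ‖lipFun f z‖) '' ball (0 : ℂ) 1)

/-- The Lipschitz seminorm of `f` on the circle. -/
noncomputable def lipSeminorm (f : LipAlgebra ω) : ℝ :=
  sSup (lipQuotients ω (lipFun f) (sphere 0 1))

theorem lipNorm_eq (f : LipAlgebra ω) : lipNorm f = supNorm f + lipSeminorm f := rfl

theorem norm_lipFun_le (f : LipAlgebra ω) {z : ℂ} (hz : z ∈ closedBall (0 : ℂ) 1) :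
    ‖lipFun f z‖ ≤ supNorm f := by
  obtain ⟨M, -, hM⟩ := discExt_bounded f.1
  have hb : BddAbove ((fun z => ‖lipFun f z‖) '' ball (0 : ℂ) 1) :=
    ⟨M, by rintro _ ⟨w, -, rfl⟩; exact hM w⟩
  have h1 : MapsTo (lipFun f) (ball 0 1) (closedBall 0 (supNorm f)) := fun w hw => by
    rw [mem_closedBall_zero_iff]
    exact le_csSup hb ⟨w, hw, rfl⟩
  have h2 := h1.closure_of_continuousOn
    (by rw [closure_ball _ one_ne_zero]; exact continuousOn_lipFun f)
  rw [closure_ball _ one_ne_zero, isClosed_closedBall.closure_eq] at h2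
  exact mem_closedBall_zero_iff.1 (h2 hz)

theorem supNorm_nonneg (f : LipAlgebra ω) : 0 ≤ supNorm f :=
  (norm_nonneg _).trans (norm_lipFun_le f (mem_closedBall_self zero_le_one))

theorem supNorm_le {f : LipAlgebra ω} {a : ℝ} (h : ∀ z ∈ ball (0 : ℂ) 1, ‖lipFun f z‖ ≤ a) :
    supNorm f ≤ a := by
  refine csSup_le ⟨_, 0, mem_ball_self one_pos, rfl⟩ ?_
  rintro _ ⟨z, hz, rfl⟩
  exact h z hz

/-- Maximum modulus principle. -/
theorem supNorm_le_of_sphere {f : LipAlgebra ω} {a : ℝ}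
    (h : ∀ z ∈ sphere (0 : ℂ) 1, ‖lipFun f z‖ ≤ a) : supNorm f ≤ a := by
  refine supNorm_le fun z hz => ?_
  refine Complex.norm_le_of_forall_mem_frontier_norm_le isBounded_ball (diffContOnCl_lipFun f)
    (fun w hw => h w ?_) (subset_closure hz)
  rwa [frontier_ball _ one_ne_zero] at hw

theorem norm_lipFun_sub_le (f : LipAlgebra ω) {ξ ζ : ℂ} (hξ : ξ ∈ sphere (0 : ℂ) 1)
    (hζ : ζ ∈ sphere (0 : ℂ) 1) :
    ‖lipFun f ξ - lipFun f ζ‖ ≤ lipSeminorm f * ω ‖ξ - ζ‖ := by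
  by_cases hne : ξ = ζ
  · simp [hne, ω.zero']
  · have h0 : 0 < ω ‖ξ - ζ‖ :=
      ω.pos (norm_pos_iff.2 (sub_ne_zero.2 hne)) (norm_sub_le_two_of_sphere hξ hζ)
    rw [← div_le_iff₀ h0]
    exact le_csSup f.2.2 ⟨ξ, hξ, ζ, hζ, hne, rfl⟩

theorem lipSeminorm_nonneg (f : LipAlgebra ω) : 0 ≤ lipSeminorm f := by
  refine Real.sSup_nonneg ?_
  rintro _ ⟨ξ, hξ, ζ, hζ, -, rfl⟩
  exact div_nonneg (norm_nonneg _) (ω.nonneg_sphere hξ hζ)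

theorem lipSeminorm_le {f : LipAlgebra ω} {a : ℝ} (ha : 0 ≤ a)
    (h : ∀ ξ ∈ sphere (0 : ℂ) 1, ∀ ζ ∈ sphere (0 : ℂ) 1,
      ‖lipFun f ξ - lipFun f ζ‖ ≤ a * ω ‖ξ - ζ‖) : lipSeminorm f ≤ a := by
  refine Real.sSup_le ?_ ha
  rintro _ ⟨ξ, hξ, ζ, hζ, hne, rfl⟩
  exact div_le_of_le_mul₀ (ω.nonneg_sphere hξ hζ) ha (h ξ hξ ζ hζ)

/-- The means by which inverses, limits and explicit functions enter the algebra. -/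
theorem exists_lipFun_eq (ω : ModulusOfContinuity) {F : ℂ → ℂ}
    (hc : ContinuousOn F (closedBall 0 1))
    (hd : DifferentiableOn ℂ F (ball 0 1)) {a : ℝ} (ha : 0 ≤ a)
    (h : ∀ ξ ∈ sphere (0 : ℂ) 1, ∀ ζ ∈ sphere (0 : ℂ) 1, ‖F ξ - F ζ‖ ≤ a * ω ‖ξ - ζ‖) :
    ∃ f : LipAlgebra ω, ∀ z ∈ closedBall (0 : ℂ) 1, lipFun f z = F z := by
  let k : C(ClosedDisc, ℂ) := ⟨fun z => F z, continuousOn_iff_continuous_domRestrict.1 hc⟩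
  have hk : ∀ z ∈ closedBall (0 : ℂ) 1, discExt k z = F z := fun z hz => discExt_of_mem _ hz
  refine ⟨⟨k, hd.congr fun z hz => hk z (ball_subset_closedBall hz), a, ?_⟩, hk⟩
  rintro _ ⟨ξ, hξ, ζ, hζ, hne, rfl⟩
  rw [hk _ (sphere_subset_closedBall hξ), hk _ (sphere_subset_closedBall hζ)]
  exact div_le_of_le_mul₀ (ω.nonneg_sphere hξ hζ) ha (h ξ hξ ζ hζ)

theorem supNorm_mul_le (f g : LipAlgebra ω) : supNorm (f * g) ≤ supNorm f * supNorm g :=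
  supNorm_le fun z hz => by
    rw [lipFun_mul, norm_mul]
    exact mul_le_mul (norm_lipFun_le f (ball_subset_closedBall hz))
      (norm_lipFun_le g (ball_subset_closedBall hz)) (norm_nonneg _) (supNorm_nonneg f)

theorem lipSeminorm_mul_le (f g : LipAlgebra ω) :
    lipSeminorm (f * g) ≤ supNorm f * lipSeminorm g + supNorm g * lipSeminorm f := by
  have hf := supNorm_nonneg f
  have hg := supNorm_nonneg g
  have hf' := lipSeminorm_nonneg f
  have hg' := lipSeminorm_nonneg g
  refine lipSeminorm_le (by positivity) fun ξ hξ ζ hζ => ?_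
  have e : lipFun (f * g) ξ - lipFun (f * g) ζ = lipFun f ξ * (lipFun g ξ - lipFun g ζ)
      + lipFun g ζ * (lipFun f ξ - lipFun f ζ) := by
    rw [lipFun_mul, lipFun_mul]; ring
  rw [e]
  refine (norm_add_le _ _).trans ?_
  rw [norm_mul, norm_mul, add_mul, mul_assoc, mul_assoc]
  gcongr
  · exact norm_lipFun_le f (sphere_subset_closedBall hξ)
  · exact norm_lipFun_sub_le g hξ hζ
  · exact norm_lipFun_le g (sphere_subset_closedBall hζ)
  · exact norm_lipFun_sub_le f hξ hζ

theorem supNorm_add_le (f g : LipAlgebra ω) : supNorm (f + g) ≤ supNorm f + supNorm g :=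
  supNorm_le fun z hz => by
    rw [lipFun_add]
    exact norm_add_le_of_le (norm_lipFun_le f (ball_subset_closedBall hz))
      (norm_lipFun_le g (ball_subset_closedBall hz))

theorem lipSeminorm_add_le (f g : LipAlgebra ω) :
    lipSeminorm (f + g) ≤ lipSeminorm f + lipSeminorm g := by
  refine lipSeminorm_le (add_nonneg (lipSeminorm_nonneg f) (lipSeminorm_nonneg g)) fun ξ hξ ζ hζ => ?_
  rw [lipFun_add, lipFun_add, add_sub_add_comm, add_mul]
  exact norm_add_le_of_le (norm_lipFun_sub_le f hξ hζ) (norm_lipFun_sub_le g hξ hζ)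

theorem supNorm_neg_le (f : LipAlgebra ω) : supNorm (-f) ≤ supNorm f :=
  supNorm_le fun z hz => by
    rw [lipFun_neg, norm_neg]
    exact norm_lipFun_le f (ball_subset_closedBall hz)

theorem lipSeminorm_neg_le (f : LipAlgebra ω) : lipSeminorm (-f) ≤ lipSeminorm f := by
  refine lipSeminorm_le (lipSeminorm_nonneg f) fun ξ hξ ζ hζ => ?_
  rw [lipFun_neg, lipFun_neg, ← neg_sub', norm_neg]
  exact norm_lipFun_sub_le f hξ hζ

theorem lipNorm_nonneg (f : LipAlgebra ω) : 0 ≤ lipNorm f :=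
  add_nonneg (supNorm_nonneg f) (lipSeminorm_nonneg f)

theorem lipNorm_mul_le (f g : LipAlgebra ω) : lipNorm (f * g) ≤ lipNorm f * lipNorm g := by
  have h1 := supNorm_mul_le f g
  have h2 := lipSeminorm_mul_le f g
  have h3 := mul_nonneg (lipSeminorm_nonneg f) (lipSeminorm_nonneg g)
  simp only [lipNorm_eq]
  nlinarith

theorem lipNorm_add_le (f g : LipAlgebra ω) : lipNorm (f + g) ≤ lipNorm f + lipNorm g := by
  have h1 := supNorm_add_le f g
  have h2 := lipSeminorm_add_le f g
  simp only [lipNorm_eq]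
  linarith

theorem lipNorm_neg (f : LipAlgebra ω) : lipNorm (-f) = lipNorm f := by
  have key : ∀ f : LipAlgebra ω, lipNorm (-f) ≤ lipNorm f := fun f =>
    add_le_add (supNorm_neg_le f) (lipSeminorm_neg_le f)
  refine le_antisymm (key f) ?_
  simpa using key (-f)

theorem lipNorm_zero : lipNorm (0 : LipAlgebra ω) = 0 := by
  refine le_antisymm ?_ (lipNorm_nonneg _)
  rw [lipNorm_eq]
  have h1 : supNorm (0 : LipAlgebra ω) ≤ 0 := supNorm_le fun z _ => by simp [lipFun_zero]
  have h2 : lipSeminorm (0 : LipAlgebra ω) ≤ 0 :=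
    lipSeminorm_le le_rfl fun ξ _ ζ _ => by simp [lipFun_zero]
  linarith

theorem eq_zero_of_lipNorm_eq_zero {f : LipAlgebra ω} (h : lipNorm f = 0) : f = 0 := by
  refine ext_lipFun fun z hz => ?_
  rw [lipFun_zero, ← norm_le_zero_iff]
  refine (norm_lipFun_le f hz).trans ?_
  have := lipSeminorm_nonneg f
  rw [lipNorm_eq] at h
  linarith

end LipAlgebra

/-! ### `Lip_ω` as a Banach algebra. -/

open Filter Topology

/-- The algebra `Lip_ω` as a normed algebra for `‖·‖_ω`. -/
def NormedLip (ω : ModulusOfContinuity) : Type := LipAlgebra ω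

namespace NormedLip

open LipAlgebra

variable {ω : ModulusOfContinuity}

noncomputable instance : CommRing (NormedLip ω) := inferInstanceAs (CommRing (LipAlgebra ω))

noncomputable instance : Algebra ℂ (NormedLip ω) := inferInstanceAs (Algebra ℂ (LipAlgebra ω))

/-- The norm `‖·‖_ω` as a ring norm. -/
noncomputable def ringNorm (ω : ModulusOfContinuity) : RingNorm (NormedLip ω) where
  toFun f := lipNorm (ω := ω) f
  map_zero' := lipNorm_zero
  add_le' := lipNorm_add_le
  neg' := lipNorm_neg
  mul_le' := lipNorm_mul_le
  eq_zero_of_map_eq_zero' _ := eq_zero_of_lipNorm_eq_zero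

noncomputable instance : NormedCommRing (NormedLip ω) :=
  { RingNorm.toNormedRing (ringNorm ω) with mul_comm := mul_comm }

noncomputable instance : NormedAlgebra ℂ (NormedLip ω) where
  norm_smul_le c f := by
    rw [Algebra.smul_def]
    refine (norm_mul_le _ _).trans (mul_le_mul_of_nonneg_right ?_ (norm_nonneg _))
    change lipNorm (algebraMap ℂ (LipAlgebra ω) c) ≤ ‖c‖
    rw [lipNorm_eq]
    have h1 : supNorm (algebraMap ℂ (LipAlgebra ω) c) ≤ ‖c‖ := supNorm_le fun z hz => by
      rw [lipFun_algebraMap _ (ball_subset_closedBall hz)]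
    have h2 : lipSeminorm (algebraMap ℂ (LipAlgebra ω) c) ≤ 0 :=
      lipSeminorm_le le_rfl fun ξ hξ ζ hζ => by
        rw [lipFun_algebraMap _ (sphere_subset_closedBall hξ),
          lipFun_algebraMap _ (sphere_subset_closedBall hζ)]
        simp
    exact (add_le_add h1 h2).trans (add_zero _).le

theorem norm_coe_le (f : LipAlgebra ω) : ‖f.1‖ ≤ lipNorm f := by
  rw [ContinuousMap.norm_le _ (lipNorm_nonneg f)]
  intro z
  have := norm_lipFun_le f z.2
  rw [lipFun, discExt_of_mem _ z.2] at this
  exact this.trans (le_add_of_nonneg_right (lipSeminorm_nonneg f))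

/-- A Cauchy sequence converges uniformly on the closed disc, and the limit is analytic inside.
Letting `m → ∞` in the seminorm bound for `v m - v n` places the limit in the algebra and gives
convergence in `‖·‖_ω`. Completeness is needed for the Gelfand–Mazur theorem. -/
instance : CompleteSpace (NormedLip ω) := by
  refine Metric.complete_of_cauchySeq_tendsto fun u hu => ?_
  let v : ℕ → LipAlgebra ω := u
  have hv : ∀ ε > 0, ∃ N, ∀ m ≥ N, ∀ n ≥ N, lipNorm (v m - v n) < ε := fun ε hε => by
    obtain ⟨N, hN⟩ := Metric.cauchySeq_iff.1 hu ε hε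
    refine ⟨N, fun m hm n hn => ?_⟩
    have := hN m hm n hn
    rwa [dist_eq_norm] at this
  have hw : CauchySeq fun n => (v n).1 := by
    refine Metric.cauchySeq_iff.2 fun ε hε => ?_
    obtain ⟨N, hN⟩ := hv ε hε
    refine ⟨N, fun m hm n hn => ?_⟩
    rw [dist_eq_norm]
    exact (norm_coe_le (v m - v n)).trans_lt (hN m hm n hn)
  obtain ⟨k, hk⟩ := cauchySeq_tendsto_of_complete hw
  have hunif : TendstoUniformlyOn (fun n => lipFun (v n)) (discExt k) atTop (closedBall 0 1) := by
    rw [Metric.tendstoUniformlyOn_iff]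
    intro ε hε
    filter_upwards [Metric.tendsto_nhds.1 hk ε hε] with n hn z hz
    rw [lipFun, discExt_of_mem _ hz, discExt_of_mem _ hz, dist_comm]
    exact (ContinuousMap.dist_apply_le_dist _).trans_lt hn
  have hdiff : DifferentiableOn ℂ (discExt k) (ball 0 1) :=
    (hunif.mono ball_subset_closedBall).tendstoLocallyUniformlyOn.differentiableOn
      (Eventually.of_forall fun n => differentiableOn_lipFun (v n)) isOpen_ball
  have hlim : ∀ z ∈ closedBall (0 : ℂ) 1, Tendsto (fun n => lipFun (v n) z) atTop
      (𝓝 (discExt k z)) := fun z hz => hunif.tendsto_at hz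
  have hlip : ∀ ε > 0, ∃ N, ∀ n ≥ N, ∀ ξ ∈ sphere (0 : ℂ) 1, ∀ ζ ∈ sphere (0 : ℂ) 1,
      ‖(lipFun (v n) ξ - discExt k ξ) - (lipFun (v n) ζ - discExt k ζ)‖ ≤ ε * ω ‖ξ - ζ‖ := by
    intro ε hε
    obtain ⟨N, hN⟩ := hv ε hε
    refine ⟨N, fun n hn ξ hξ ζ hζ => ?_⟩
    have hl := (((tendsto_const_nhds (x := lipFun (v n) ξ)).sub
      (hlim ξ (sphere_subset_closedBall hξ))).sub ((tendsto_const_nhds (x := lipFun (v n) ζ)).sub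
      (hlim ζ (sphere_subset_closedBall hζ)))).norm
    refine le_of_tendsto hl ?_
    filter_upwards [eventually_ge_atTop N] with m hm
    rw [← lipFun_sub, ← lipFun_sub]
    refine (norm_lipFun_sub_le _ hξ hζ).trans
      (mul_le_mul_of_nonneg_right ?_ (ω.nonneg_sphere hξ hζ))
    have h1 := hN n hn m hm
    rw [lipNorm_eq] at h1
    linarith [supNorm_nonneg (v n - v m)]
  obtain ⟨K, hK⟩ : ∃ K : LipAlgebra ω, ∀ z ∈ closedBall (0 : ℂ) 1, lipFun K z = discExt k z := by
    obtain ⟨N, hN⟩ := hlip 1 one_pos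
    refine exists_lipFun_eq ω (continuousOn_discExt k) hdiff
      (a := 1 + lipSeminorm (v N)) (add_nonneg zero_le_one (lipSeminorm_nonneg _))
      fun ξ hξ ζ hζ => ?_
    have e : discExt k ξ - discExt k ζ = (lipFun (v N) ξ - lipFun (v N) ζ) -
      ((lipFun (v N) ξ - discExt k ξ) - (lipFun (v N) ζ - discExt k ζ)) := by ring
    rw [e, add_mul, add_comm]
    exact (_root_.norm_sub_le _ _).trans
      (add_le_add (norm_lipFun_sub_le _ hξ hζ) (hN N le_rfl ξ hξ ζ hζ))
  refine ⟨K, Metric.tendsto_atTop.2 fun ε hε => ?_⟩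
  obtain ⟨N₁, hN₁⟩ := hlip (ε / 3) (by positivity)
  obtain ⟨N₂, hN₂⟩ := eventually_atTop.1 (Metric.tendstoUniformlyOn_iff.1 hunif (ε / 3)
    (by positivity))
  refine ⟨max N₁ N₂, fun n hn => ?_⟩
  refine (dist_eq_norm (u n) _).trans_lt ?_
  change lipNorm (v n - K) < ε
  have h1 : supNorm (v n - K) ≤ ε / 3 := supNorm_le fun z hz => by
    rw [lipFun_sub, hK z (ball_subset_closedBall hz), ← dist_eq_norm, dist_comm]
    exact (hN₂ n ((le_max_right _ _).trans hn) z (ball_subset_closedBall hz)).le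
  have h2 : lipSeminorm (v n - K) ≤ ε / 3 := lipSeminorm_le (by positivity) fun ξ hξ ζ hζ => by
    rw [lipFun_sub, lipFun_sub, hK _ (sphere_subset_closedBall hξ),
      hK _ (sphere_subset_closedBall hζ)]
    exact hN₁ n ((le_max_left _ _).trans hn) ξ hξ ζ hζ
  rw [lipNorm_eq]
  linarith

end NormedLip

/-! ### Maximal ideals of `Lip_ω` and cancellation modulo an ideal. -/

namespace LipAlgebra

variable {ω : ModulusOfContinuity}

/-- By compactness `|f|` has a positive minimum `m`, and differences of `1 / f` are at most those of
`f` divided by `m ^ 2`. -/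
theorem isUnit_of_forall_ne_zero {f : LipAlgebra ω}
    (h : ∀ z ∈ closedBall (0 : ℂ) 1, lipFun f z ≠ 0) : IsUnit f := by
  obtain ⟨z₀, hz₀, hmin⟩ := (isCompact_closedBall (0 : ℂ) 1).exists_isMinOn
    ⟨0, mem_closedBall_self zero_le_one⟩ (continuousOn_lipFun f).norm
  set m := ‖lipFun f z₀‖
  have hm : 0 < m := norm_pos_iff.2 (h z₀ hz₀)
  have hle : ∀ z ∈ closedBall (0 : ℂ) 1, m ≤ ‖lipFun f z‖ := fun z hz => hmin hz
  obtain ⟨k, hk⟩ := exists_lipFun_eq ω ((continuousOn_lipFun f).inv₀ h)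
    ((differentiableOn_lipFun f).inv fun z hz => h z (ball_subset_closedBall hz))
    (a := lipSeminorm f / m ^ 2) (div_nonneg (lipSeminorm_nonneg f) (by positivity))
    (fun ξ hξ ζ hζ => by
      have hξ' := sphere_subset_closedBall hξ
      have hζ' := sphere_subset_closedBall hζ
      simp only [Pi.inv_apply]
      rw [inv_sub_inv (h ξ hξ') (h ζ hζ'), norm_div, norm_mul, norm_sub_rev, div_mul_eq_mul_div,
        sq]
      have h1 := norm_lipFun_sub_le f hξ hζ
      have h2 := mul_nonneg (lipSeminorm_nonneg f) (ω.nonneg_sphere hξ hζ)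
      have h3 := hle ξ hξ'
      have h4 := hle ζ hζ'
      gcongr)
  refine IsUnit.of_mul_eq_one k (ext_lipFun fun z hz => ?_)
  rw [lipFun_mul, hk z hz, lipFun_one hz, Pi.inv_apply, mul_inv_cancel₀ (h z hz)]

/-- Otherwise `f - χ f` has no zeros, hence is invertible, yet `χ` kills it. Since the bound is by
the supremum norm alone, uniform approximation by polynomials will determine `χ`; density in `‖·‖_ω`
is not required. -/
theorem norm_algHom_le (χ : LipAlgebra ω →ₐ[ℂ] ℂ) (f : LipAlgebra ω) : ‖χ f‖ ≤ supNorm f := by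
  by_contra! hlt
  have : IsUnit (f - algebraMap ℂ _ (χ f)) := isUnit_of_forall_ne_zero fun z hz h0 => by
    rw [lipFun_sub, lipFun_algebraMap _ hz, sub_eq_zero] at h0
    have := norm_lipFun_le f hz
    rw [h0] at this
    linarith
  have h1 := this.map χ
  rw [map_sub, AlgHom.commutes, Algebra.algebraMap_self_apply, sub_self] at h1
  exact not_isUnit_zero h1

theorem exists_polynomial_near {F : ℂ → ℂ} (hc : ContinuousOn F (closedBall 0 1))
    (hd : DifferentiableOn ℂ F (ball 0 1)) {ε : ℝ} (hε : 0 < ε) :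
    ∃ p : Polynomial ℂ, ∀ z ∈ closedBall (0 : ℂ) 1, ‖F z - p.eval z‖ ≤ ε := by
  have huc := (isCompact_closedBall (0 : ℂ) 1).uniformContinuousOn_of_continuous hc
  obtain ⟨δ, hδ, h⟩ := Metric.uniformContinuousOn_iff.1 huc (ε / 2) (by positivity)
  -- Approximate `F` by its dilation `F (r z)`, then that by a Taylor polynomial. The radii satisfy
  -- `r < t < s < 1`: the series represents `F` on the ball of radius `s` and converges uniformly on
  -- that of radius `t`, which contains every `r z`.
  obtain ⟨r, hr, hr1⟩ : ∃ r, max (1 - δ) 0 < r ∧ r < 1 :=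
    exists_between (max_lt (by linarith) one_pos)
  have hr0 : 0 < r := (le_max_right _ _).trans_lt hr
  have hrδ : 1 - r < δ := by linarith [(le_max_left (1 - δ) 0).trans_lt hr]
  have hnorm : ∀ z ∈ closedBall (0 : ℂ) 1, ‖(r : ℂ) * z‖ ≤ r := fun z hz => by
    rw [norm_mul, Complex.norm_of_nonneg hr0.le]
    exact mul_le_of_le_one_right hr0.le (mem_closedBall_zero_iff.1 hz)
  obtain ⟨s, hs, hs1⟩ := exists_between hr1
  have hs0 := hr0.trans hs
  lift s to NNReal using hs0.le
  have hps := (hd.mono (closedBall_subset_ball hs1)).hasFPowerSeriesOnBall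
    (c := (0 : ℂ)) (NNReal.coe_pos.1 hs0)
  obtain ⟨t, hrt, hts⟩ := exists_between hs
  lift t to NNReal using (hr0.trans hrt).le
  have htu := hps.tendstoUniformlyOn (r' := t) (ENNReal.coe_lt_coe.2 (NNReal.coe_lt_coe.1 hts))
  obtain ⟨n, hn⟩ := (Metric.tendstoUniformlyOn_iff.1 htu (ε / 2) (by positivity)).exists
  refine ⟨∑ k ∈ Finset.range n,
    Polynomial.C ((cauchyPowerSeries F 0 s).coeff k * (r : ℂ) ^ k) * Polynomial.X ^ k,
    fun z hz => ?_⟩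
  have h1 : ‖F z - F (r * z)‖ < ε / 2 := by
    rw [← dist_eq_norm]
    refine h z hz _ (mem_closedBall_zero_iff.2 ((hnorm z hz).trans hr1.le)) ?_
    rw [dist_eq_norm]
    have e : z - r * z = ((1 - r : ℝ) : ℂ) * z := by push_cast; ring
    rw [e, norm_mul, Complex.norm_of_nonneg (by linarith)]
    exact (mul_le_of_le_one_right (by linarith) (mem_closedBall_zero_iff.1 hz)).trans_lt hrδ
  have h2 := hn (r * z) (mem_ball_zero_iff.2 ((hnorm z hz).trans_lt hrt))
  rw [zero_add, dist_eq_norm] at h2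
  have e : Polynomial.eval z (∑ k ∈ Finset.range n,
      Polynomial.C ((cauchyPowerSeries F 0 s).coeff k * (r : ℂ) ^ k) * Polynomial.X ^ k)
      = (cauchyPowerSeries F 0 s).partialSum n (r * z) := by
    rw [Polynomial.eval_finsetSum, FormalMultilinearSeries.partialSum]
    refine Finset.sum_congr rfl fun k _ => ?_
    rw [FormalMultilinearSeries.apply_eq_pow_smul_coeff]
    simp only [Polynomial.eval_mul, Polynomial.eval_C, Polynomial.eval_pow, Polynomial.eval_X,
      smul_eq_mul]
    ring
  rw [e]
  calc _ = ‖(F z - F (r * z)) + (F (r * z) - (cauchyPowerSeries F 0 s).partialSum n (r * z))‖ := by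
        congr 1; ring
    _ ≤ ε / 2 + ε / 2 := (norm_add_le _ _).trans (add_le_add h1.le h2.le)
    _ = ε := by ring

/-- Evaluation at a point of the closed disc. -/
noncomputable def evalHom (ω : ModulusOfContinuity) (z : ℂ) (hz : z ∈ closedBall (0 : ℂ) 1) :
    LipAlgebra ω →ₐ[ℂ] ℂ where
  toFun f := lipFun f z
  map_one' := lipFun_one hz
  map_mul' f g := lipFun_mul f g z
  map_zero' := lipFun_zero z
  map_add' f g := lipFun_add f g z
  commutes' c := lipFun_algebraMap c hz

theorem exists_lipFun_eq_id (ω : ModulusOfContinuity) :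
    ∃ Z : LipAlgebra ω, ∀ z ∈ closedBall (0 : ℂ) 1, lipFun Z z = z := by
  have h2 : 0 < ω 2 := ω.pos two_pos le_rfl
  refine exists_lipFun_eq ω continuousOn_id differentiableOn_id (a := 2 / ω 2) (by positivity)
    fun ξ hξ ζ hζ => ?_
  have := ω.mul_le (norm_nonneg (ξ - ζ)) (norm_sub_le_two_of_sphere hξ hζ)
  calc ‖id ξ - id ζ‖ = 2 / ω 2 * (ω 2 / 2 * ‖ξ - ζ‖) := by simp only [id]; field_simp
    _ ≤ _ := by gcongr

/-- The point is the value of `χ` at the coordinate function. Both `χ` and evaluation there agree on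
polynomials and are bounded by the supremum norm. -/
theorem exists_algHom_eq_lipFun (χ : LipAlgebra ω →ₐ[ℂ] ℂ) :
    ∃ w ∈ closedBall (0 : ℂ) 1, ∀ f, χ f = lipFun f w := by
  obtain ⟨Z, hZ⟩ := exists_lipFun_eq_id ω
  have hw : χ Z ∈ closedBall (0 : ℂ) 1 := by
    rw [mem_closedBall_zero_iff]
    refine (norm_algHom_le χ Z).trans (supNorm_le fun z hz => ?_)
    rw [hZ z (ball_subset_closedBall hz)]
    exact (mem_ball_zero_iff.1 hz).le
  refine ⟨χ Z, hw, fun f => ?_⟩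
  rw [← sub_eq_zero, ← norm_le_zero_iff]
  refine le_of_forall_pos_le_add fun ε hε => ?_
  obtain ⟨p, hp⟩ := exists_polynomial_near (continuousOn_lipFun f) (differentiableOn_lipFun f)
    (half_pos hε)
  have hpz : ∀ z ∈ closedBall (0 : ℂ) 1, lipFun (Polynomial.aeval Z p) z = p.eval z := by
    intro z hz
    have := Polynomial.aeval_algHom_apply (evalHom ω z hz) Z p
    change Polynomial.aeval (lipFun Z z) p = lipFun (Polynomial.aeval Z p) z at this
    rw [← this, hZ z hz, Polynomial.coe_aeval_eq_eval]
  have hpχ : χ (Polynomial.aeval Z p) = p.eval (χ Z) := by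
    rw [← Polynomial.aeval_algHom_apply, Polynomial.coe_aeval_eq_eval]
  have h1 : ‖χ (f - Polynomial.aeval Z p)‖ ≤ ε / 2 :=
    (norm_algHom_le _ _).trans (supNorm_le fun z hz => by
      rw [lipFun_sub, hpz z (ball_subset_closedBall hz)]
      exact hp z (ball_subset_closedBall hz))
  rw [map_sub, hpχ] at h1
  have h2 := hp _ hw
  calc ‖χ f - lipFun f (χ Z)‖
      = ‖(χ f - p.eval (χ Z)) - (lipFun f (χ Z) - p.eval (χ Z))‖ := by congr 1; ring
    _ ≤ ε / 2 + ε / 2 := (_root_.norm_sub_le _ _).trans (add_le_add h1 h2)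
    _ = 0 + ε := by ring

/-- Gelfand–Mazur: a maximal ideal containing `J` is the kernel of a character, and characters are
evaluations. -/
theorem exists_forall_mem_lipFun_eq_zero {J : Ideal (LipAlgebra ω)} (hJ : J ≠ ⊤) :
    ∃ w ∈ closedBall (0 : ℂ) 1, ∀ f ∈ J, lipFun f w = 0 := by
  obtain ⟨M, hM, hJM⟩ := Ideal.exists_le_maximal J hJ
  let M' : Ideal (NormedLip ω) := M
  have : M'.IsMaximal := hM
  let χ : LipAlgebra ω →ₐ[ℂ] ℂ :=
    WeakDual.CharacterSpace.toAlgHom (A := NormedLip ω) M'.toCharacterSpace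
  obtain ⟨w, hw, h⟩ := exists_algHom_eq_lipFun χ
  refine ⟨w, hw, fun f hf => ?_⟩
  rw [← h]
  exact M'.toCharacterSpace_apply_eq_zero_of_mem (hJM hf)

/-- `K` and `v` have no common zero, so they generate the unit ideal; multiply `1 = k + a * v` by
`u`. -/
theorem mem_of_mul_mem_of_forall_ne_zero {K : Ideal (LipAlgebra ω)} {u v : LipAlgebra ω}
    (huv : u * v ∈ K)
    (h : ∀ w ∈ closedBall (0 : ℂ) 1, (∀ f ∈ K, lipFun f w = 0) → lipFun v w ≠ 0) : u ∈ K := by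
  have htop : K ⊔ Ideal.span {v} = ⊤ := by
    by_contra hne
    obtain ⟨w, hw, h0⟩ := exists_forall_mem_lipFun_eq_zero hne
    exact h w hw (fun f hf => h0 f (Ideal.mem_sup_left hf))
      (h0 v (Ideal.mem_sup_right (Ideal.mem_span_singleton_self v)))
  have h1 : (1 : LipAlgebra ω) ∈ K ⊔ Ideal.span {v} := htop ▸ Submodule.mem_top
  obtain ⟨k, hk, y, hy, hky⟩ := Submodule.mem_sup.1 h1
  obtain ⟨a, rfl⟩ := Ideal.mem_span_singleton'.1 hy
  have : u = u * k + a * (u * v) := by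
    calc u = u * (k + a * v) := by rw [hky, mul_one]
      _ = _ := by ring
  rw [this]
  exact K.add_mem (K.mul_mem_left _ hk) (K.mul_mem_left _ huv)

end LipAlgebra

/-! ### Herglotz integrals of measures on closed subsets of the circle. -/

open MeasureTheory

/-- The Herglotz integral `∫ (ξ + z) / (ξ - z) dν(ξ)` of a measure. -/
noncomputable def herglotzIntegral (ν : Measure ℂ) (z : ℂ) : ℂ := ∫ ξ, (ξ + z) / (ξ - z) ∂ν

/-- The zero-free function `exp (- ∫ (ξ + z) / (ξ - z) dν(ξ))`. -/
noncomputable def herglotzExp (ν : Measure ℂ) (z : ℂ) : ℂ := Complex.exp (-herglotzIntegral ν z)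

/-- On the right half-plane, which is convex, the derivative of `exp (-z)` has modulus at most `1`.
-/
theorem norm_exp_neg_sub_exp_neg_le {a b : ℂ} (ha : 0 ≤ a.re) (hb : 0 ≤ b.re) :
    ‖Complex.exp (-a) - Complex.exp (-b)‖ ≤ ‖a - b‖ := by
  have hconv : Convex ℝ {z : ℂ | 0 ≤ z.re} := convex_halfSpace_re_ge 0
  have := hconv.norm_image_sub_le_of_norm_hasDerivWithin_le (f := fun z => Complex.exp (-z))
    (f' := fun z => -Complex.exp (-z)) (C := 1) (x := b) (y := a) (fun z _ => by
      simpa using ((hasDerivAt_neg z).cexp).hasDerivWithinAt) (fun z hz => by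
      rw [norm_neg, Complex.norm_exp, Real.exp_le_one_iff]
      simpa using hz) hb ha
  simpa using this

theorem re_herglotz_kernel {ξ z : ℂ} :
    ((ξ + z) / (ξ - z)).re = (‖ξ‖ ^ 2 - ‖z‖ ^ 2) / ‖ξ - z‖ ^ 2 := by
  have := congrFun (poissonKernel_eq_re_herglotzRieszKernel (c := 0) (w := z)) ξ
  simpa [poissonKernel, herglotzRieszKernel] using this.symm

section Herglotz

variable {ν : Measure ℂ} [IsFiniteMeasure ν] {S : Set ℂ}

theorem integrable_herglotz_kernel (hS : IsCompact S) (hν : ∀ᵐ ξ ∂ν, ξ ∈ S) {z : ℂ} (hz : z ∉ S) :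
    Integrable (fun ξ => (ξ + z) / (ξ - z)) ν := by
  rw [← Measure.restrict_eq_self_of_ae_mem hν]
  refine ContinuousOn.integrableOn_compact hS ?_
  refine ContinuousOn.div (by fun_prop) (by fun_prop) fun ξ hξ h => hz ?_
  rw [sub_eq_zero] at h
  rwa [← h]

theorem re_herglotzIntegral (hS : IsCompact S) (hν : ∀ᵐ ξ ∂ν, ξ ∈ S) {z : ℂ} (hz : z ∉ S) :
    (herglotzIntegral ν z).re = ∫ ξ, (‖ξ‖ ^ 2 - ‖z‖ ^ 2) / ‖ξ - z‖ ^ 2 ∂ν := by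
  have := integral_re (integrable_herglotz_kernel hS hν hz)
  simp only [RCLike.re_to_complex, re_herglotz_kernel] at this
  exact this.symm

theorem re_herglotzIntegral_nonneg (hS : IsCompact S) (hS1 : S ⊆ sphere 0 1)
    (hν : ∀ᵐ ξ ∂ν, ξ ∈ S) {z : ℂ} (hz : z ∉ S) (hz1 : ‖z‖ ≤ 1) :
    0 ≤ (herglotzIntegral ν z).re := by
  rw [re_herglotzIntegral hS hν hz]
  refine integral_nonneg_of_ae ?_
  filter_upwards [hν] with ξ hξ
  have h1 := mem_sphere_zero_iff_norm.1 (hS1 hξ)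
  have : ‖z‖ ^ 2 ≤ 1 := pow_le_one₀ (norm_nonneg _) hz1
  simp only [Pi.zero_apply, h1]
  exact div_nonneg (by linarith) (by positivity)

theorem norm_herglotzExp (ν : Measure ℂ) (z : ℂ) :
    ‖herglotzExp ν z‖ = Real.exp (-(herglotzIntegral ν z).re) := by
  rw [herglotzExp, Complex.norm_exp, Complex.neg_re]

theorem herglotzExp_ne_zero (ν : Measure ℂ) (z : ℂ) : herglotzExp ν z ≠ 0 := Complex.exp_ne_zero _

theorem norm_herglotzExp_le_one (hS : IsCompact S) (hS1 : S ⊆ sphere 0 1)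
    (hν : ∀ᵐ ξ ∂ν, ξ ∈ S) {z : ℂ} (hz : z ∉ S) (hz1 : ‖z‖ ≤ 1) : ‖herglotzExp ν z‖ ≤ 1 := by
  rw [norm_herglotzExp, Real.exp_le_one_iff]
  have := re_herglotzIntegral_nonneg hS hS1 hν hz hz1
  linarith

/-- The Poisson kernel vanishes at boundary points different from its pole. -/
theorem norm_herglotzExp_eq_one (hS : IsCompact S) (hS1 : S ⊆ sphere 0 1)
    (hν : ∀ᵐ ξ ∂ν, ξ ∈ S) {z : ℂ} (hz : z ∉ S) (hz1 : ‖z‖ = 1) : ‖herglotzExp ν z‖ = 1 := by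
  rw [norm_herglotzExp, re_herglotzIntegral hS hν hz, integral_eq_zero_of_ae, neg_zero,
    Real.exp_zero]
  filter_upwards [hν] with ξ hξ
  have h1 := mem_sphere_zero_iff_norm.1 (hS1 hξ)
  simp [h1, hz1]

/-- The difference of the kernels is `2ξ(z - w) / ((ξ - z)(ξ - w))`, so only the product of the two
distances matters. -/
theorem norm_herglotzIntegral_sub_le (hS : IsCompact S) (hS1 : S ⊆ sphere 0 1)
    (hν : ∀ᵐ ξ ∂ν, ξ ∈ S) {z w : ℂ} (hz : z ∉ S) (hw : w ∉ S) {κ : ℝ} (hκ : 0 < κ)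
    (h : ∀ ξ ∈ S, κ ≤ ‖ξ - z‖ * ‖ξ - w‖) :
    ‖herglotzIntegral ν z - herglotzIntegral ν w‖ ≤ 2 * ‖z - w‖ / κ * ν.real univ := by
  rw [herglotzIntegral, herglotzIntegral, ← integral_sub (integrable_herglotz_kernel hS hν hz)
    (integrable_herglotz_kernel hS hν hw)]
  refine norm_integral_le_of_norm_le_const ?_
  filter_upwards [hν] with ξ hξ
  have hz' : ξ - z ≠ 0 := fun h0 => hz (by rwa [← sub_eq_zero.1 h0])
  have hw' : ξ - w ≠ 0 := fun h0 => hw (by rwa [← sub_eq_zero.1 h0])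
  have e : (ξ + z) / (ξ - z) - (ξ + w) / (ξ - w) = 2 * ξ * (z - w) / ((ξ - z) * (ξ - w)) := by
    field_simp
    ring
  rw [e, norm_div, norm_mul, norm_mul, norm_mul, mem_sphere_zero_iff_norm.1 (hS1 hξ)]
  simp only [Complex.norm_ofNat, mul_one]
  gcongr
  exact h ξ hξ

theorem norm_herglotzExp_sub_le (hS : IsCompact S) (hS1 : S ⊆ sphere 0 1)
    (hν : ∀ᵐ ξ ∂ν, ξ ∈ S) {z w : ℂ} (hz : z ∉ S) (hw : w ∉ S) (hz1 : ‖z‖ ≤ 1) (hw1 : ‖w‖ ≤ 1)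
    {κ : ℝ} (hκ : 0 < κ) (h : ∀ ξ ∈ S, κ ≤ ‖ξ - z‖ * ‖ξ - w‖) :
    ‖herglotzExp ν z - herglotzExp ν w‖ ≤ 2 * ‖z - w‖ / κ * ν.real univ :=
  (norm_exp_neg_sub_exp_neg_le (re_herglotzIntegral_nonneg hS hS1 hν hz hz1)
    (re_herglotzIntegral_nonneg hS hS1 hν hw hw1)).trans
    (norm_herglotzIntegral_sub_le hS hS1 hν hz hw hκ h)

theorem norm_one_sub_herglotzExp_le (hS : IsCompact S) (hS1 : S ⊆ sphere 0 1)
    (hν : ∀ᵐ ξ ∂ν, ξ ∈ S) {z : ℂ} (hz : z ∉ S) (hz1 : ‖z‖ ≤ 1) {r : ℝ} (hr : 0 < r)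
    (h : ∀ ξ ∈ S, r ≤ ‖ξ - z‖) :
    ‖1 - herglotzExp ν z‖ ≤ 2 / r * ν.real univ := by
  have h1 := norm_exp_neg_sub_exp_neg_le (a := 0) (b := herglotzIntegral ν z) le_rfl
    (re_herglotzIntegral_nonneg hS hS1 hν hz hz1)
  rw [neg_zero, Complex.exp_zero, zero_sub, norm_neg] at h1
  refine h1.trans ?_
  refine norm_integral_le_of_norm_le_const ?_
  filter_upwards [hν] with ξ hξ
  rw [norm_div]
  have := norm_add_le ξ z
  rw [mem_sphere_zero_iff_norm.1 (hS1 hξ)] at this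
  gcongr
  · linarith
  · exact h ξ hξ

theorem differentiableAt_herglotzIntegral (hS : IsCompact S) (hS1 : S ⊆ sphere 0 1)
    (hν : ∀ᵐ ξ ∂ν, ξ ∈ S) {z : ℂ} (hz : z ∉ S) : DifferentiableAt ℂ (herglotzIntegral ν) z := by
  obtain ⟨r, hr, hball⟩ := Metric.isOpen_iff.1 hS.isClosed.isOpen_compl z hz
  have hdist : ∀ w ∈ ball z (r / 2), ∀ ξ ∈ S, r / 2 ≤ ‖ξ - w‖ := fun w hw ξ hξ => by
    have h1 : r ≤ ‖ξ - z‖ := by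
      by_contra! hlt
      exact hball (mem_ball_iff_norm.2 hlt) hξ
    have h2 := mem_ball_iff_norm.1 hw
    have h3 := norm_add_le (ξ - w) (w - z)
    rw [sub_add_sub_cancel] at h3
    linarith
  have hmeas : ∀ w : ℂ, AEStronglyMeasurable (fun ξ : ℂ => (ξ + w) / (ξ - w)) ν := fun w =>
    (by fun_prop : Measurable fun ξ : ℂ => (ξ + w) / (ξ - w)).aestronglyMeasurable
  refine (hasDerivAt_integral_of_dominated_loc_of_deriv_le (μ := ν)
    (F := fun w ξ => (ξ + w) / (ξ - w))
    (F' := fun w ξ => (1 * (ξ - w) - (ξ + w) * (-1)) / (ξ - w) ^ 2)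
    (bound := fun _ => 2 / (r / 2) ^ 2) (ball_mem_nhds z (half_pos hr))
    (Eventually.of_forall hmeas) (integrable_herglotz_kernel hS hν hz)
    (by fun_prop : Measurable fun ξ : ℂ => _).aestronglyMeasurable ?_
    (integrable_const _) ?_).2.differentiableAt
  · filter_upwards [hν] with ξ hξ w hw
    have e : 1 * (ξ - w) - (ξ + w) * (-1) = 2 * ξ := by ring
    rw [e, norm_div, norm_mul, norm_pow, mem_sphere_zero_iff_norm.1 (hS1 hξ)]
    simp only [Complex.norm_ofNat, mul_one]
    gcongr
    exact hdist w hw ξ hξ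
  · filter_upwards [hν] with ξ hξ w hw
    refine HasDerivAt.fun_div ((hasDerivAt_id w).const_add ξ) ((hasDerivAt_id w).const_sub ξ) ?_
    intro h0
    have h1 := hdist w hw ξ hξ
    rw [h0, norm_zero] at h1
    linarith

theorem differentiableAt_herglotzExp (hS : IsCompact S) (hS1 : S ⊆ sphere 0 1)
    (hν : ∀ᵐ ξ ∂ν, ξ ∈ S) {z : ℂ} (hz : z ∉ S) : DifferentiableAt ℂ (herglotzExp ν) z :=
  (differentiableAt_herglotzIntegral hS hS1 hν hz).neg.cexp

end Herglotz

/-! ### Arc length, and boundary uniqueness on sets of positive length. -/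

/-- Normalized arc length on the unit circle. -/
noncomputable def arcMeasure : Measure ℂ :=
  Measure.map (circleMap 0 1)
    (ENNReal.ofReal (2 * Real.pi)⁻¹ • volume.restrict (Ioc 0 (2 * Real.pi)))

instance : IsFiniteMeasure
    (ENNReal.ofReal (2 * Real.pi)⁻¹ • volume.restrict (Ioc 0 (2 * Real.pi))) :=
  Measure.smul_finite _ ENNReal.ofReal_ne_top

instance : IsFiniteMeasure arcMeasure := by unfold arcMeasure; infer_instance

theorem ae_mem_sphere_arcMeasure : ∀ᵐ ξ ∂arcMeasure, ξ ∈ sphere (0 : ℂ) 1 := by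
  refine (ae_map_iff (measurable_circleMap 0 1).aemeasurable
    (p := fun ξ => ξ ∈ sphere (0 : ℂ) 1) isClosed_sphere.measurableSet).2 ?_
  exact Eventually.of_forall fun θ => circleMap_mem_sphere _ zero_le_one _

theorem integral_arcMeasure {E : Type*} [NormedAddCommGroup E] [NormedSpace ℝ E] {F : ℂ → E}
    (hF : AEStronglyMeasurable F arcMeasure) :
    ∫ ξ, F ξ ∂arcMeasure = Real.circleAverage F 0 1 := by
  rw [arcMeasure, integral_map (measurable_circleMap 0 1).aemeasurable hF, integral_smul_measure,
    Real.circleAverage_def, intervalIntegral.integral_of_le Real.two_pi_pos.le,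
    ENNReal.toReal_ofReal (by positivity)]

theorem integrable_arcMeasure {E : Type*} [NormedAddCommGroup E] {F : ℂ → E}
    (hF : AEStronglyMeasurable F arcMeasure) (h : CircleIntegrable F 0 1) :
    Integrable F arcMeasure := by
  rw [arcMeasure, integrable_map_measure hF (measurable_circleMap 0 1).aemeasurable]
  refine Integrable.smul_measure ?_ ENNReal.ofReal_ne_top
  exact (intervalIntegrable_iff_integrableOn_Ioc_of_le Real.two_pi_pos.le).1 h

theorem measurable_herglotz_kernel (z : ℂ) : Measurable fun ξ : ℂ => (ξ + z) / (ξ - z) := by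
  fun_prop

theorem not_mem_sphere_of_mem_ball {z : ℂ} (hz : z ∈ ball (0 : ℂ) 1) : z ∉ sphere (0 : ℂ) 1 :=
  fun h => (mem_ball.1 hz).ne h

theorem herglotzIntegral_arcMeasure {z : ℂ} (hz : z ∈ ball (0 : ℂ) 1) :
    herglotzIntegral arcMeasure z = 1 := by
  rw [herglotzIntegral, integral_arcMeasure (measurable_herglotz_kernel z).aestronglyMeasurable,
    Real.circleAverage_eq_circleIntegral one_ne_zero]
  have hne : ∀ ξ ∈ sphere (0 : ℂ) 1, ξ - z ≠ 0 := fun ξ hξ h => by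
    rw [sub_eq_zero.1 h] at hξ
    exact not_mem_sphere_of_mem_ball hz hξ
  have hne0 : ∀ ξ ∈ sphere (0 : ℂ) 1, ξ - 0 ≠ 0 := fun ξ hξ h => by
    rw [sub_zero] at h
    simp [h] at hξ
  -- Partial fractions reduce the integral to two Cauchy integrals, `2` and `1` times `2πi`.
  have e : ∮ ξ in C(0, 1), (ξ - 0)⁻¹ • ((ξ + z) / (ξ - z))
      = ∮ ξ in C(0, 1), ((2 : ℂ) • (ξ - z)⁻¹ - (ξ - 0)⁻¹) := by
    refine circleIntegral.integral_congr zero_le_one fun ξ hξ => ?_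
    have h1 := hne ξ hξ
    have h2 := hne0 ξ hξ
    simp only [smul_eq_mul, sub_zero] at h2 ⊢
    field_simp
    ring
  have i1 : CircleIntegrable (fun ξ => (2 : ℂ) • (ξ - z)⁻¹) 0 1 :=
    ContinuousOn.circleIntegrable zero_le_one
      (((continuousOn_id.sub continuousOn_const).inv₀ hne).const_smul (2 : ℂ))
  have i2 : CircleIntegrable (fun ξ : ℂ => (ξ - 0)⁻¹) 0 1 :=
    ContinuousOn.circleIntegrable zero_le_one
      ((continuousOn_id.sub continuousOn_const).inv₀ hne0)
  rw [e, circleIntegral.integral_sub i1 i2, circleIntegral.integral_smul,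
    circleIntegral.integral_sub_inv_of_mem_ball hz,
    circleIntegral.integral_sub_inv_of_mem_ball (mem_ball_self one_pos)]
  simp only [smul_eq_mul]
  field_simp
  norm_num

/-- Let `H` be the Herglotz exponential of arc length on `E`. Then `|H| = 1` on the circle off `E`
and `|H| < 1` inside, so the maximum principle for `h / H ^ n` gives `|h| ≤ M |H| ^ n` inside; let
`n → ∞`. -/
theorem eq_zero_of_eqOn_zero_of_arcMeasure_pos {E : Set ℂ} (hE : IsClosed E)
    (hE1 : E ⊆ sphere 0 1) (hpos : 0 < arcMeasure E) {h : ℂ → ℂ} (hd : DiffContOnCl ℂ h (ball 0 1))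
    (h0 : ∀ z ∈ E, h z = 0) {z : ℂ} (hz : z ∈ ball (0 : ℂ) 1) : h z = 0 := by
  have hEc : IsCompact E := (isCompact_sphere 0 1).of_isClosed_subset hE hE1
  set ν := arcMeasure.restrict E with hν_def
  have hν : ∀ᵐ ξ ∂ν, ξ ∈ E := ae_restrict_mem hE.measurableSet
  have hc : ContinuousOn h (closedBall 0 1) := by
    rw [← closure_ball (0 : ℂ) one_ne_zero]; exact hd.continuousOn
  have hnotE : ∀ w ∈ ball (0 : ℂ) 1, w ∉ E := fun w hw hwE =>
    not_mem_sphere_of_mem_ball hw (hE1 hwE)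
  -- The Poisson kernel has total mass `1`, hence `|H| ≥ 1 / e`. This lower bound makes `h / H ^ n`
  -- tend to `0` at `E`, so that it extends continuously by `0`.
  have hle1 : ∀ w ∈ closedBall (0 : ℂ) 1, w ∉ E → (herglotzIntegral ν w).re ≤ 1 := by
    intro w hw hwE
    rcases (mem_closedBall_zero_iff.1 hw).lt_or_eq with hlt | heq
    · have hwb : w ∈ ball (0 : ℂ) 1 := mem_ball_zero_iff.2 hlt
      have h1 := congrArg Complex.re (herglotzIntegral_arcMeasure hwb)
      rw [re_herglotzIntegral (isCompact_sphere 0 1) ae_mem_sphere_arcMeasure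
        (not_mem_sphere_of_mem_ball hwb), Complex.one_re] at h1
      rw [re_herglotzIntegral hEc hν hwE, ← h1]
      refine setIntegral_le_integral ?_ ?_
      · have := (integrable_herglotz_kernel (isCompact_sphere 0 1) ae_mem_sphere_arcMeasure
          (not_mem_sphere_of_mem_ball hwb)).re
        simpa only [RCLike.re_to_complex, re_herglotz_kernel] using this
      · filter_upwards [ae_mem_sphere_arcMeasure] with ξ hξ
        rw [mem_sphere_zero_iff_norm] at hξ
        have : ‖w‖ ^ 2 ≤ 1 := pow_le_one₀ (norm_nonneg _) hlt.le
        simp only [Pi.zero_apply, hξ]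
        exact div_nonneg (by linarith) (by positivity)
    · have := norm_herglotzExp_eq_one hEc hE1 hν hwE heq
      rw [norm_herglotzExp, Real.exp_eq_one_iff] at this
      linarith
  obtain ⟨M, hM⟩ := (isCompact_closedBall (0 : ℂ) 1).exists_bound_of_continuousOn hc
  have hM0 : 0 ≤ M := (norm_nonneg _).trans (hM 0 (mem_closedBall_self zero_le_one))
  have key : ∀ n : ℕ, ‖h z‖ ≤ M * ‖herglotzExp ν z‖ ^ n := by
    intro n
    classical
    let F : ℂ → ℂ := fun w => if w ∈ E then 0 else h w / herglotzExp ν w ^ n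
    have hFE : ∀ w ∉ E, F w = h w / herglotzExp ν w ^ n := fun w hw => if_neg hw
    have hFle : ∀ w ∈ closedBall (0 : ℂ) 1, ‖F w‖ ≤ ‖h w‖ * Real.exp 1 ^ n := by
      intro w hw
      by_cases hwE : w ∈ E
      · simp only [F, if_pos hwE, norm_zero]; positivity
      · rw [hFE w hwE, norm_div, norm_pow, norm_herglotzExp, div_eq_mul_inv, ← inv_pow,
          ← Real.exp_neg, neg_neg]
        gcongr
        exact hle1 w hw hwE
    have hdiff : ∀ w ∉ E, DifferentiableAt ℂ (fun w => herglotzExp ν w ^ n) w := fun w hw =>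
      (differentiableAt_herglotzExp hEc hE1 hν hw).pow n
    have hFd : DiffContOnCl ℂ F (ball 0 1) := by
      refine ⟨?_, ?_⟩
      · refine DifferentiableOn.congr (f := fun w => h w / herglotzExp ν w ^ n) ?_
          fun w hw => hFE w (hnotE w hw)
        exact hd.differentiableOn.div (fun w hw => (hdiff w (hnotE w hw)).differentiableWithinAt)
          fun w _ => pow_ne_zero n (herglotzExp_ne_zero ν w)
      · rw [closure_ball _ one_ne_zero]
        intro w hw
        by_cases hwE : w ∈ E
        · have hFw : F w = 0 := if_pos hwE
          rw [ContinuousWithinAt, hFw]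
          have h1 : Tendsto (fun w => ‖h w‖ * Real.exp 1 ^ n) (𝓝[closedBall 0 1] w) (𝓝 0) := by
            have := Tendsto.mul_const (Real.exp 1 ^ n) (hc w hw).norm
            simp only [h0 w hwE, norm_zero, zero_mul] at this
            exact this
          refine squeeze_zero_norm' ?_ h1
          filter_upwards [self_mem_nhdsWithin] with v hv using hFle v hv
        · have h1 : ContinuousWithinAt (fun w => h w / herglotzExp ν w ^ n) (closedBall 0 1) w :=
            (hc w hw).div (hdiff w hwE).continuousAt.continuousWithinAt
              (pow_ne_zero n (herglotzExp_ne_zero ν w))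
          refine h1.congr_of_eventuallyEq ?_ (hFE w hwE)
          filter_upwards [mem_nhdsWithin_of_mem_nhds (hE.isOpen_compl.mem_nhds hwE)] with v hv
            using hFE v hv
    have hmax := Complex.norm_le_of_forall_mem_frontier_norm_le isBounded_ball hFd (C := M)
      (fun w hw => by
        rw [frontier_ball _ one_ne_zero] at hw
        by_cases hwE : w ∈ E
        · simp only [F, if_pos hwE, norm_zero]; exact hM0
        · rw [hFE w hwE, norm_div, norm_pow, norm_herglotzExp_eq_one hEc hE1 hν hwE
            (mem_sphere_zero_iff_norm.1 hw), one_pow, div_one]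
          exact hM w (sphere_subset_closedBall hw)) (subset_closure hz)
    rw [hFE z (hnotE z hz), norm_div, norm_pow, div_le_iff₀
      (pow_pos (norm_pos_iff.2 (herglotzExp_ne_zero ν z)) n)] at hmax
    exact hmax
  have hlt1 : ‖herglotzExp ν z‖ < 1 := by
    rw [norm_herglotzExp, Real.exp_lt_one_iff, neg_lt_zero, re_herglotzIntegral hEc hν (hnotE z hz)]
    have hz1 := mem_ball_zero_iff.1 hz
    have hint : Integrable (fun ξ => (‖ξ‖ ^ 2 - ‖z‖ ^ 2) / ‖ξ - z‖ ^ 2) ν := by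
      have := (integrable_herglotz_kernel hEc hν (hnotE z hz)).re
      simpa only [RCLike.re_to_complex, re_herglotz_kernel] using this
    have hz2 : ‖z‖ ^ 2 < 1 := pow_lt_one₀ (norm_nonneg _) hz1 two_ne_zero
    have hle : ∫ _ξ, (1 - ‖z‖ ^ 2) / 4 ∂ν ≤ ∫ ξ, (‖ξ‖ ^ 2 - ‖z‖ ^ 2) / ‖ξ - z‖ ^ 2 ∂ν := by
      refine integral_mono_ae (integrable_const _) hint ?_
      filter_upwards [hν] with ξ hξ
      have hξ1 := mem_sphere_zero_iff_norm.1 (hE1 hξ)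
      have h2 : ‖ξ - z‖ ≤ 2 := (norm_sub_le _ _).trans (by linarith)
      have h3 : 0 < ‖ξ - z‖ := norm_pos_iff.2 fun h0 => hnotE z hz (by rwa [← sub_eq_zero.1 h0])
      have h4 : ‖ξ - z‖ ^ 2 ≤ 4 := by nlinarith
      simp only [hξ1, one_pow]
      gcongr
    refine lt_of_lt_of_le ?_ hle
    rw [integral_const, smul_eq_mul]
    have : 0 < ν.real univ := by
      rw [measureReal_def, hν_def, Measure.restrict_apply_univ]
      exact ENNReal.toReal_pos hpos.ne' (measure_ne_top _ _)
    have : 0 < (1 - ‖z‖ ^ 2) / 4 := by linarith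
    positivity
  have hlim : Tendsto (fun n => M * ‖herglotzExp ν z‖ ^ n) atTop (𝓝 (M * 0)) :=
    (tendsto_pow_atTop_nhds_zero_of_lt_one (norm_nonneg _) hlt1).const_mul M
  rw [mul_zero] at hlim
  exact norm_le_zero_iff.1 (ge_of_tendsto' hlim key)

/-! ### The measure of an outer function. -/

namespace LipAlgebra

variable {ω : ModulusOfContinuity}

/-- The measure has density `log R - log |f|` with respect to arc length; the constant `log R` has
Herglotz integral `log R`, which accounts for the factor `R`. -/
theorem IsOuter.exists_measure {f : LipAlgebra ω} (hf : IsOuter f) {R : ℝ} (hR : 1 ≤ R)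
    (hfR : ∀ z ∈ closedBall (0 : ℂ) 1, ‖lipFun f z‖ ≤ R) :
    ∃ ν : Measure ℂ, IsFiniteMeasure ν ∧ ν ≪ arcMeasure ∧ ∃ c : ℂ, ‖c‖ = 1 ∧
      ∀ z ∈ ball (0 : ℂ) 1, lipFun f z = R * c * herglotzExp ν z := by
  obtain ⟨hint, c, hc, h⟩ := hf
  have hR0 : 0 < R := one_pos.trans_le hR
  let U : ℂ → ℝ := fun ξ => Real.log R - Real.log ‖lipFun f ξ‖
  have hmeasf : AEMeasurable (lipFun f) arcMeasure := by
    rw [← Measure.restrict_eq_self_of_ae_mem ae_mem_sphere_arcMeasure]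
    exact ((continuousOn_lipFun f).mono sphere_subset_closedBall).aemeasurable
      isClosed_sphere.measurableSet
  have hlog : AEMeasurable (fun ξ => Real.log ‖lipFun f ξ‖) arcMeasure :=
    Real.measurable_log.comp_aemeasurable hmeasf.norm
  have hlogi : Integrable (fun ξ => Real.log ‖lipFun f ξ‖) arcMeasure :=
    integrable_arcMeasure hlog.aestronglyMeasurable hint
  have hU : AEMeasurable U arcMeasure := hlog.const_sub _
  have hUi : Integrable U arcMeasure := (integrable_const _).sub hlogi
  have hU0 : ∀ᵐ ξ ∂arcMeasure, 0 ≤ U ξ := by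
    filter_upwards [ae_mem_sphere_arcMeasure] with ξ hξ
    simp only [U, sub_nonneg]
    -- At a zero of `f` the convention `log 0 = 0` makes the density `log R`, which is nonnegative
    -- because `R ≥ 1`.
    rcases (norm_nonneg (lipFun f ξ)).eq_or_lt with h0 | h0
    · rw [← h0, Real.log_zero]; exact Real.log_nonneg hR
    · exact Real.log_le_log h0 (hfR ξ (sphere_subset_closedBall hξ))
  refine ⟨arcMeasure.withDensity fun ξ => ENNReal.ofReal (U ξ),
    isFiniteMeasure_withDensity_ofReal hUi.2, withDensity_absolutelyContinuous _ _, c, hc,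
    fun z hz => ?_⟩
  have hzs := not_mem_sphere_of_mem_ball hz
  have hker := integrable_herglotz_kernel (isCompact_sphere (0 : ℂ) 1) ae_mem_sphere_arcMeasure hzs
  have hbdd : ∃ C, ∀ᵐ ξ ∂arcMeasure, ‖(ξ + z) / (ξ - z)‖ ≤ C := by
    obtain ⟨C, hC⟩ := (isCompact_sphere (0 : ℂ) 1).exists_bound_of_continuousOn
      (f := fun ξ => (ξ + z) / (ξ - z)) (ContinuousOn.div (by fun_prop) (by fun_prop)
        fun ξ hξ h0 => hzs (by rwa [← sub_eq_zero.1 h0]))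
    exact ⟨C, ae_mem_sphere_arcMeasure.mono hC⟩
  obtain ⟨C, hC⟩ := hbdd
  have hprod : Integrable (fun ξ => (ξ + z) / (ξ - z) * (Real.log ‖lipFun f ξ‖ : ℂ)) arcMeasure :=
    hlogi.ofReal.bdd_mul (measurable_herglotz_kernel z).aestronglyMeasurable hC
  have e : herglotzIntegral (arcMeasure.withDensity fun ξ => ENNReal.ofReal (U ξ)) z
      = Real.log R - Real.circleAverage
        (fun ξ => (ξ + z) / (ξ - z) * (Real.log ‖lipFun f ξ‖ : ℂ)) 0 1 := by
    rw [herglotzIntegral, integral_withDensity_eq_integral_toReal_smul₀ hU.ennreal_ofReal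
      (Eventually.of_forall fun _ => ENNReal.ofReal_lt_top), ← integral_arcMeasure hprod.1]
    have h1 : ∫ ξ, (Real.log R : ℂ) * ((ξ + z) / (ξ - z)) ∂arcMeasure = Real.log R := by
      rw [integral_const_mul]
      have := herglotzIntegral_arcMeasure hz
      rw [herglotzIntegral] at this
      rw [this, mul_one]
    rw [← h1, ← integral_sub (hker.const_mul _) hprod]
    refine integral_congr_ae ?_
    filter_upwards [hU0] with ξ hξ
    rw [ENNReal.toReal_ofReal hξ, Complex.real_smul]
    simp only [U]
    push_cast
    ring
  rw [h z hz, herglotzExp, e, neg_sub, Complex.exp_sub, ← Complex.ofReal_exp, Real.exp_log hR0]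
  have : (R : ℂ) ≠ 0 := Complex.ofReal_ne_zero.2 hR0.ne'
  field_simp

end LipAlgebra

/-! ### Arcs of the circle and the partition adapted to `E`. -/

theorem norm_circleMap_sub_circleMap (a b : ℝ) :
    ‖circleMap 0 1 a - circleMap 0 1 b‖ = ‖circleMap 0 1 (a - b) - 1‖ := by
  have e : circleMap 0 1 a - circleMap 0 1 b = circleMap 0 1 b * (circleMap 0 1 (a - b) - 1) := by
    simp only [circleMap_zero, Complex.ofReal_one, one_mul, mul_sub, ← Complex.exp_add, mul_one]
    congr 2
    push_cast
    ring
  rw [e, norm_mul]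
  simp [circleMap_zero, Complex.norm_exp_ofReal_mul_I]

theorem norm_circleMap_sub_one_sq (a : ℝ) : ‖circleMap 0 1 a - 1‖ ^ 2 = 2 - 2 * Real.cos a := by
  rw [circleMap_zero, Complex.ofReal_one, one_mul, Complex.exp_mul_I, ← Complex.normSq_eq_norm_sq,
    Complex.normSq_apply]
  simp only [Complex.sub_re, Complex.sub_im, Complex.add_re, Complex.add_im, Complex.mul_re,
    Complex.mul_im, Complex.I_re, Complex.I_im, Complex.one_re, Complex.one_im,
    Complex.cos_ofReal_re, Complex.cos_ofReal_im, Complex.sin_ofReal_re, Complex.sin_ofReal_im]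
  nlinarith [Real.sin_sq_add_cos_sq a]

theorem norm_circleMap_sub_one_le_of_abs_le {a b : ℝ} (hab : |a| ≤ |b|) (hb : |b| ≤ Real.pi) :
    ‖circleMap 0 1 a - 1‖ ≤ ‖circleMap 0 1 b - 1‖ := by
  refine (sq_le_sq₀ (norm_nonneg _) (norm_nonneg _)).1 ?_
  rw [norm_circleMap_sub_one_sq, norm_circleMap_sub_one_sq, ← Real.cos_abs a, ← Real.cos_abs b]
  have := Real.strictAntiOn_cos.antitoneOn ⟨abs_nonneg a, hab.trans hb⟩ ⟨abs_nonneg b, hb⟩ hab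
  linarith

theorem norm_circleMap_sub_circleMap_le (a b : ℝ) :
    ‖circleMap 0 1 a - circleMap 0 1 b‖ ≤ |a - b| := by
  rw [norm_circleMap_sub_circleMap]
  refine abs_le_of_sq_le_sq' ?_ (abs_nonneg _) |>.2
  rw [norm_circleMap_sub_one_sq, sq_abs]
  have := Real.one_sub_sq_div_two_le_cos (x := a - b)
  linarith

theorem exists_circleMap_eq {z : ℂ} (hz : z ∈ sphere (0 : ℂ) 1) :
    ∃ a, |a| ≤ Real.pi ∧ circleMap 0 1 a = z := by
  refine ⟨z.arg, Complex.abs_arg_le_pi z, ?_⟩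
  have := Complex.norm_mul_exp_arg_mul_I z
  rw [mem_sphere_zero_iff_norm.1 hz] at this
  rw [circleMap_zero, this]

/-- Between points of two closed sets covering the circle there is a common point. -/
theorem exists_mem_inter_between {Γ Γ' : Set ℂ} (hΓ : IsClosed Γ) (hΓ' : IsClosed Γ')
    (hcover : Γ ∪ Γ' = sphere 0 1) {ξ ζ : ℂ} (hξ : ξ ∈ Γ) (hζ : ζ ∈ Γ') :
    ∃ p ∈ Γ ∩ Γ', ‖ξ - p‖ ≤ ‖ξ - ζ‖ ∧ ‖ζ - p‖ ≤ ‖ξ - ζ‖ := by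
  have hξ1 : ξ ∈ sphere (0 : ℂ) 1 := hcover ▸ Or.inl hξ
  have hζ1 : ζ ∈ sphere (0 : ℂ) 1 := hcover ▸ Or.inr hζ
  obtain ⟨a, -, rfl⟩ := exists_circleMap_eq hξ1
  -- With `|c| ≤ π` the path from `ξ` to `ζ` follows a shortest arc, on which chord length increases
  -- with the angle. Connectedness of this arc gives the common point.
  obtain ⟨c, hc, hcζ⟩ : ∃ c, |c| ≤ Real.pi ∧ circleMap 0 1 c = ζ / circleMap 0 1 a :=
    exists_circleMap_eq (by
      rw [mem_sphere_zero_iff_norm, norm_div, mem_sphere_zero_iff_norm.1 hξ1,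
        mem_sphere_zero_iff_norm.1 hζ1, div_one])
  have hζ' : ζ = circleMap 0 1 (a + c) := by
    have h0 : circleMap 0 1 a ≠ 0 := circleMap_ne_center one_ne_zero
    rw [eq_div_iff h0] at hcζ
    rw [← hcζ]
    simp only [circleMap_zero, Complex.ofReal_one, one_mul, ← Complex.exp_add]
    congr 1
    push_cast
    ring
  subst hζ'
  let γ : ℝ → ℂ := fun t => circleMap 0 1 (a + t * c)
  have hγ : Continuous γ := (continuous_circleMap 0 1).comp (by fun_prop)
  have hpre : IsPreconnected (γ '' Icc 0 1) := isPreconnected_Icc.image γ hγ.continuousOn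
  have hsub : γ '' Icc 0 1 ⊆ Γ ∪ Γ' := by
    rintro _ ⟨t, -, rfl⟩
    rw [hcover]
    exact circleMap_mem_sphere _ zero_le_one _
  obtain ⟨_, ⟨t, ht, rfl⟩, hp⟩ := isPreconnected_closed_iff.1 hpre Γ Γ' hΓ hΓ' hsub
    ⟨_, ⟨0, ⟨le_rfl, zero_le_one⟩, rfl⟩, by simpa [γ] using hξ⟩
    ⟨_, ⟨1, ⟨zero_le_one, le_rfl⟩, rfl⟩, by simpa [γ] using hζ⟩
  refine ⟨_, hp, ?_, ?_⟩
  all_goals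
    rw [norm_circleMap_sub_circleMap, norm_circleMap_sub_circleMap]
    refine norm_circleMap_sub_one_le_of_abs_le ?_ ?_
  · rw [show a - (a + t * c) = -(t * c) by ring, show a - (a + c) = -c by ring, abs_neg, abs_neg,
      abs_mul, abs_of_nonneg ht.1]
    exact mul_le_of_le_one_left (abs_nonneg c) ht.2
  · rwa [show a - (a + c) = -c by ring, abs_neg]
  · rw [show a + c - (a + t * c) = (1 - t) * c by ring, show a - (a + c) = -c by ring, abs_neg,
      abs_mul, abs_of_nonneg (by linarith [ht.2])]
    exact mul_le_of_le_one_left (abs_nonneg c) (by linarith [ht.1])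
  · rwa [show a - (a + c) = -c by ring, abs_neg]

/-- The `j`-th of `M` equal arcs of the unit circle. -/
noncomputable def circleArc (M j : ℕ) : Set ℂ :=
  (fun t : ℝ => circleMap 0 1 (2 * Real.pi / M * t)) '' Icc j (j + 1)

theorem isClosed_circleArc (M j : ℕ) : IsClosed (circleArc M j) :=
  (isCompact_Icc.image ((continuous_circleMap 0 1).comp (by fun_prop))).isClosed

theorem circleArc_subset (M j : ℕ) : circleArc M j ⊆ sphere 0 1 := by
  rintro _ ⟨t, -, rfl⟩
  exact circleMap_mem_sphere _ zero_le_one _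

theorem norm_sub_le_of_mem_circleArc {M j : ℕ} {x y : ℂ} (hx : x ∈ circleArc M j)
    (hy : y ∈ circleArc M j) : ‖x - y‖ ≤ 7 / M := by
  obtain ⟨s, hs, rfl⟩ := hx
  obtain ⟨t, ht, rfl⟩ := hy
  refine (norm_circleMap_sub_circleMap_le _ _).trans ?_
  rw [← mul_sub, abs_mul, abs_of_nonneg (by positivity)]
  have h1 : |s - t| ≤ 1 := abs_le.2 ⟨by linarith [hs.1, ht.2], by linarith [hs.2, ht.1]⟩
  calc 2 * Real.pi / M * |s - t| ≤ 2 * Real.pi / M * 1 := by gcongr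
    -- Here `7` rounds up `2π`.
    _ ≤ 7 / M := by
      rw [mul_one]
      gcongr
      linarith [Real.pi_lt_d2]

theorem exists_mem_circleArc {M : ℕ} (hM : 0 < M) {x : ℂ} (hx : x ∈ sphere (0 : ℂ) 1) :
    ∃ j < M, x ∈ circleArc M j := by
  have hM' : (0 : ℝ) < M := Nat.cast_pos.2 hM
  have hπ := Real.pi_pos
  rw [← abs_one (α := ℝ), ← image_circleMap_Ioc] at hx
  obtain ⟨θ, hθ, rfl⟩ := hx
  obtain ⟨t, ht⟩ : ∃ t, t = M / (2 * Real.pi) * θ := ⟨_, rfl⟩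
  have hθt : θ = 2 * Real.pi / M * t := by rw [ht]; field_simp
  have ht0 : 0 < t := by rw [ht]; exact mul_pos (by positivity) hθ.1
  have htM : t ≤ M := by
    rw [ht, div_mul_eq_mul_div, div_le_iff₀ (by positivity)]
    exact mul_le_mul_of_nonneg_left hθ.2 hM'.le
  have hceil : 0 < ⌈t⌉₊ := Nat.ceil_pos.2 ht0
  have hle := Nat.le_ceil t
  have hlt := Nat.ceil_lt_add_one ht0.le
  -- The angle is taken in `(0, 2π]`, so `0 < t ≤ M` and this index is a natural number less than
  -- `M`.
  refine ⟨⌈t⌉₊ - 1, ?_, t, ⟨?_, ?_⟩, by rw [hθt]⟩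
  · have : ⌈t⌉₊ ≤ M := Nat.ceil_le.2 htM
    omega
  · rw [Nat.cast_pred hceil]; linarith
  · rw [Nat.cast_pred hceil]; linarith

theorem mem_roots_of_mem_circleArc {M i j : ℕ} (hi : i < M) (hj : j < M) (hij : i ≠ j) {x : ℂ}
    (hx : x ∈ circleArc M i) (hx' : x ∈ circleArc M j) :
    x ∈ (Finset.range M).image fun k : ℕ => circleMap 0 1 (2 * Real.pi / M * k) := by
  have hM : 0 < M := by omega
  have hM' : (0 : ℝ) < M := Nat.cast_pos.2 hM
  have hπ := Real.pi_pos
  obtain ⟨s, hs, rfl⟩ := hx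
  obtain ⟨t, ht, hts⟩ := hx'
  obtain ⟨n, hn⟩ := (circleMap_eq_circleMap_iff 0 one_ne_zero).1 hts
  have hst : t = s + n * M := by
    have h2 := congrArg Complex.im hn
    simp at h2
    field_simp at h2
    linarith
  have hi' : (i : ℝ) + 1 ≤ M := by exact_mod_cast hi
  have hj' : (j : ℝ) + 1 ≤ M := by exact_mod_cast hj
  have hi0 : (0 : ℝ) ≤ i := Nat.cast_nonneg i
  have hj0 : (0 : ℝ) ≤ j := Nat.cast_nonneg j
  have hnat : ∃ k : ℕ, s = k := by
    have hn1 : (n : ℝ) ≤ 1 := by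
      by_contra! h
      have : (2 : ℝ) ≤ n := by exact_mod_cast (by exact_mod_cast h : (1 : ℤ) < n)
      nlinarith [hs.1, ht.2]
    have hn2 : (-1 : ℝ) ≤ n := by
      by_contra! h
      have : (n : ℝ) ≤ -2 := by
        have : n < -1 := by exact_mod_cast h
        exact_mod_cast (by omega : n ≤ -2)
      nlinarith [hs.2, ht.1]
    have hn1' : n ≤ 1 := by exact_mod_cast hn1
    have hn2' : -1 ≤ n := by exact_mod_cast hn2
    -- Two parameters of one point differ by `n * M` with `|n| ≤ 1`. If `n = ±1` the point is where
    -- the circle closes up, and `s` is `M` or `0`; if `n = 0`, distinct arcs share only an integer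
    -- endpoint.
    interval_cases n
    · refine ⟨M, ?_⟩
      push_cast at hst
      linarith [hs.2, ht.1]
    · push_cast at hst
      have e : t = s := by linarith
      rcases lt_or_gt_of_ne hij with h | h
      · refine ⟨i + 1, ?_⟩
        have : (i : ℝ) + 1 ≤ j := by exact_mod_cast h
        push_cast
        linarith [hs.2, ht.1]
      · refine ⟨i, ?_⟩
        have : (j : ℝ) + 1 ≤ i := by exact_mod_cast h
        linarith [hs.1, ht.2]
    · refine ⟨0, ?_⟩
      push_cast at hst ⊢
      linarith [hs.1, ht.2]
  obtain ⟨k, rfl⟩ := hnat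
  rw [Finset.mem_image]
  have hkM : k ≤ M := by
    have : (k : ℝ) ≤ M := hs.2.trans hi'
    exact_mod_cast this
  rcases hkM.lt_or_eq with h | h
  · exact ⟨k, Finset.mem_range.2 h, rfl⟩
  · refine ⟨0, Finset.mem_range.2 hM, ?_⟩
    subst h
    have e1 : 2 * Real.pi / k * k = 0 + 2 * Real.pi := by field_simp; ring
    simp only [e1]
    rw [periodic_circleMap]
    simp

/-- Sort the `M` arcs by whether they come within `1 / M` of `E`. An arc has diameter at most `7 /
M`, whence `8 / M`; arcs of different kinds meet only at `M`-th roots of unity. -/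
theorem exists_circle_partition (E : Set ℂ) {M : ℕ} (hM : 0 < M) :
    ∃ (Γ Γ' : Set ℂ) (S : Finset ℂ), IsClosed Γ ∧ IsClosed Γ' ∧ Γ ∪ Γ' = sphere 0 1 ∧
      (S : Set ℂ) = Γ ∩ Γ' ∧ S.card ≤ M ∧ (∀ x ∈ Γ', ∀ e ∈ E, 1 / (M : ℝ) < ‖x - e‖) ∧
      ∀ x ∈ Γ, ∃ e ∈ E, ‖x - e‖ ≤ 8 / M := by
  classical
  let P : ℕ → Prop := fun j => ∃ x ∈ circleArc M j, ∃ e ∈ E, ‖x - e‖ ≤ 1 / (M : ℝ)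
  let J := (Finset.range M).filter P
  let J' := (Finset.range M).filter fun j => ¬ P j
  let Γ : Set ℂ := ⋃ j ∈ J, circleArc M j
  let Γ' : Set ℂ := ⋃ j ∈ J', circleArc M j
  let R : Finset ℂ := (Finset.range M).image fun k : ℕ => circleMap 0 1 (2 * Real.pi / M * k)
  have hsub : Γ ∩ Γ' ⊆ R := by
    rintro x ⟨hx, hx'⟩
    simp only [Γ, Γ', mem_iUnion, exists_prop, J, J', Finset.mem_filter, Finset.mem_range] at hx hx'
    obtain ⟨i, ⟨hi, hPi⟩, hxi⟩ := hx
    obtain ⟨j, ⟨hj, hPj⟩, hxj⟩ := hx'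
    refine mem_roots_of_mem_circleArc hi hj ?_ hxi hxj
    rintro rfl
    exact hPj hPi
  refine ⟨Γ, Γ', R.filter fun x => x ∈ Γ ∩ Γ', ?_, ?_, ?_, ?_, ?_, ?_, ?_⟩
  · exact isClosed_biUnion_finset fun j _ => isClosed_circleArc M j
  · exact isClosed_biUnion_finset fun j _ => isClosed_circleArc M j
  · refine Subset.antisymm ?_ fun x hx => ?_
    · exact union_subset (iUnion₂_subset fun j _ => circleArc_subset M j)
        (iUnion₂_subset fun j _ => circleArc_subset M j)
    · obtain ⟨j, hj, hxj⟩ := exists_mem_circleArc hM hx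
      by_cases hP : P j
      · exact Or.inl (mem_biUnion (Finset.mem_filter.2 ⟨Finset.mem_range.2 hj, hP⟩) hxj)
      · exact Or.inr (mem_biUnion (Finset.mem_filter.2 ⟨Finset.mem_range.2 hj, hP⟩) hxj)
  · ext x
    simp only [Finset.coe_filter, mem_ofPred_eq]
    exact ⟨fun h => h.2, fun h => ⟨hsub h, h⟩⟩
  · exact (Finset.card_filter_le _ _).trans (Finset.card_image_le.trans (Finset.card_range M).le)
  · intro x hx e he
    simp only [Γ', mem_iUnion, exists_prop, J', Finset.mem_filter, Finset.mem_range] at hx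
    obtain ⟨j, ⟨-, hPj⟩, hxj⟩ := hx
    by_contra! hle
    exact hPj ⟨x, hxj, e, he, hle⟩
  · intro x hx
    simp only [Γ, mem_iUnion, exists_prop, J, Finset.mem_filter, Finset.mem_range] at hx
    obtain ⟨j, ⟨-, y, hy, e, he, hye⟩, hxj⟩ := hx
    refine ⟨e, he, ?_⟩
    have h1 := norm_sub_le_of_mem_circleArc hxj hy
    calc ‖x - e‖ = ‖(x - y) + (y - e)‖ := by rw [sub_add_sub_cancel]
      _ ≤ 7 / M + 1 / M := (norm_add_le _ _).trans (add_le_add h1 hye)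
      _ = 8 / M := by ring

/-! ### Functions vanishing at finitely many points of the circle. -/

theorem norm_prod_sub_prod_le {ι : Type*} (s : Finset ι) {u v : ι → ℂ}
    (hu : ∀ i ∈ s, ‖u i‖ ≤ 1) (hv : ∀ i ∈ s, ‖v i‖ ≤ 1) :
    ‖∏ i ∈ s, u i - ∏ i ∈ s, v i‖ ≤ ∑ i ∈ s, ‖u i - v i‖ := by
  classical
  induction s using Finset.induction_on with
  | empty => simp
  | insert a s ha ih =>
    rw [Finset.prod_insert ha, Finset.prod_insert ha, Finset.sum_insert ha]
    have hs : ‖∏ i ∈ s, v i‖ ≤ 1 := by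
      rw [norm_prod]
      exact Finset.prod_le_one (fun _ _ => norm_nonneg _)
        fun i hi => hv i (Finset.mem_insert_of_mem hi)
    have h1 := ih (fun i hi => hu i (Finset.mem_insert_of_mem hi))
      fun i hi => hv i (Finset.mem_insert_of_mem hi)
    have e : u a * ∏ i ∈ s, u i - v a * ∏ i ∈ s, v i
        = u a * (∏ i ∈ s, u i - ∏ i ∈ s, v i) + (u a - v a) * ∏ i ∈ s, v i := by ring
    rw [e]
    refine (norm_add_le _ _).trans ?_
    rw [norm_mul, norm_mul, add_comm]
    exact add_le_add (mul_le_of_le_one_right (norm_nonneg _) hs)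
      ((mul_le_of_le_one_left (norm_nonneg _) (hu a (Finset.mem_insert_self a s))).trans h1)

/-- A product of factors `(z - p) / (z - (1 + ε) p)`, which vanishes at the points `p ∈ S` of the
circle and is close to `1` away from them. -/
noncomputable def zeroFactor (S : Finset ℂ) (ε : ℝ) (z : ℂ) : ℂ :=
  ∏ p ∈ S, (z - p) / (z - (1 + ε) * p)

section ZeroFactor

variable {S : Finset ℂ} {ε : ℝ} {p z w : ℂ}

theorem norm_sub_le_norm_sub_one_add_mul (hp : ‖p‖ = 1) (hε : 0 ≤ ε) (hz : ‖z‖ ≤ 1) :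
    ‖z - p‖ ≤ ‖z - (1 + ε) * p‖ := by
  refine (sq_le_sq₀ (norm_nonneg _) (norm_nonneg _)).1 ?_
  have e : z - (1 + ε) * p = (z - p) - (ε : ℝ) • p := by
    rw [Complex.real_smul]; ring
  rw [e, norm_sub_sq_real (z - p), inner_smul_right, inner_sub_left, real_inner_self_eq_norm_sq, hp]
  have h1 : inner ℝ z p ≤ 1 := (real_inner_le_norm z p).trans (by rw [hp, mul_one]; exact hz)
  have h2 := mul_nonneg hε (sub_nonneg.2 h1)
  have h3 := sq_nonneg ‖ε • p‖
  nlinarith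

theorem le_norm_sub_one_add_mul (hp : ‖p‖ = 1) (hε : 0 ≤ ε) (hz : ‖z‖ ≤ 1) :
    ε ≤ ‖z - (1 + ε) * p‖ := by
  have h1 := norm_sub_norm_le ((1 + ε) * p) z
  rw [norm_mul, hp, mul_one, norm_sub_rev] at h1
  have h2 : ‖(1 + ε : ℂ)‖ = 1 + ε := by
    rw [← Complex.ofReal_one, ← Complex.ofReal_add, Complex.norm_of_nonneg (by linarith)]
  linarith

theorem sub_one_add_mul_ne_zero (hp : ‖p‖ = 1) (hε : 0 < ε) (hz : ‖z‖ ≤ 1) :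
    z - (1 + ε) * p ≠ 0 := fun h => by
  have := le_norm_sub_one_add_mul hp hε.le hz
  rw [h, norm_zero] at this
  linarith

theorem norm_factor_le_one (hp : ‖p‖ = 1) (hε : 0 < ε) (hz : ‖z‖ ≤ 1) :
    ‖(z - p) / (z - (1 + ε) * p)‖ ≤ 1 := by
  rw [norm_div]
  exact div_le_one_of_le₀ (norm_sub_le_norm_sub_one_add_mul hp hε.le hz) (norm_nonneg _)

theorem norm_zeroFactor_le_one (hS : ∀ p ∈ S, ‖p‖ = 1) (hε : 0 < ε) (hz : ‖z‖ ≤ 1) : ‖zeroFactor S ε z‖ ≤ 1 := by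
  rw [zeroFactor, norm_prod]
  exact Finset.prod_le_one (fun _ _ => norm_nonneg _) fun p hp => norm_factor_le_one (hS p hp) hε hz

/-- Each factor is `1 + εp / (z - (1 + ε)p)`, so a difference gains `ε`. Away from `S` this is small
when `S.card * ε` is; with `κ = ε ^ 2` it gives the crude global constant `S.card / ε`. -/
theorem norm_zeroFactor_sub_le (hS : ∀ p ∈ S, ‖p‖ = 1) (hε : 0 < ε) (hz : ‖z‖ ≤ 1) (hw : ‖w‖ ≤ 1) {κ : ℝ} (hκ : 0 < κ)
    (h : ∀ p ∈ S, κ ≤ ‖z - (1 + ε) * p‖ * ‖w - (1 + ε) * p‖) :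
    ‖zeroFactor S ε z - zeroFactor S ε w‖ ≤ S.card * ε * ‖z - w‖ / κ := by
  refine (norm_prod_sub_prod_le S (fun p hp => norm_factor_le_one (hS p hp) hε hz)
    fun p hp => norm_factor_le_one (hS p hp) hε hw).trans ?_
  rw [mul_assoc, mul_div_assoc, ← nsmul_eq_mul]
  refine Finset.sum_le_card_nsmul S _ _ fun p hp => ?_
  have h1 := sub_one_add_mul_ne_zero (hS p hp) hε hz
  have h2 := sub_one_add_mul_ne_zero (hS p hp) hε hw
  have e : (z - p) / (z - (1 + ε) * p) - (w - p) / (w - (1 + ε) * p)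
      = ε * p * (w - z) / ((z - (1 + ε) * p) * (w - (1 + ε) * p)) := by
    rw [div_sub_div _ _ h1 h2]
    congr 1
    ring
  rw [e, norm_div, norm_mul, norm_mul, norm_mul, hS p hp, mul_one, Complex.norm_of_nonneg hε.le,
    norm_sub_rev]
  gcongr
  exact h p hp

theorem norm_zeroFactor_sub_le_div (hS : ∀ p ∈ S, ‖p‖ = 1) (hε : 0 < ε) (hz : ‖z‖ ≤ 1) (hw : ‖w‖ ≤ 1) :
    ‖zeroFactor S ε z - zeroFactor S ε w‖ ≤ S.card / ε * ‖z - w‖ := by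
  refine (norm_zeroFactor_sub_le hS hε hz hw (mul_pos hε hε) fun p hp => ?_).trans_eq ?_
  · exact mul_le_mul (le_norm_sub_one_add_mul (hS p hp) hε.le hz)
      (le_norm_sub_one_add_mul (hS p hp) hε.le hw) hε.le (norm_nonneg _)
  · field_simp

theorem norm_one_sub_zeroFactor_le (hS : ∀ p ∈ S, ‖p‖ = 1) (hε : 0 < ε) (hz : ‖z‖ ≤ 1) {r : ℝ} (hr : 0 < r)
    (h : ∀ p ∈ S, r ≤ ‖p - z‖) : ‖1 - zeroFactor S ε z‖ ≤ S.card * ε / r := by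
  have h1 := norm_prod_sub_prod_le S (u := fun _ => (1 : ℂ)) (fun _ _ => norm_one.le)
    fun p hp => norm_factor_le_one (hS p hp) hε hz
  rw [Finset.prod_const_one] at h1
  refine h1.trans ?_
  rw [mul_div_assoc, ← nsmul_eq_mul]
  refine Finset.sum_le_card_nsmul S _ _ fun p hp => ?_
  have h2 := sub_one_add_mul_ne_zero (hS p hp) hε hz
  have e : 1 - (z - p) / (z - (1 + ε) * p) = -(ε * p) / (z - (1 + ε) * p) := by
    rw [one_sub_div h2]
    congr 1
    ring
  rw [e, norm_div, norm_neg, norm_mul, hS p hp, mul_one, Complex.norm_of_nonneg hε.le]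
  gcongr
  have := h p hp
  rw [norm_sub_rev] at this
  exact this.trans (norm_sub_le_norm_sub_one_add_mul (hS p hp) hε.le hz)

theorem zeroFactor_ne_zero (hS : ∀ p ∈ S, ‖p‖ = 1) (hε : 0 < ε) (hz : ‖z‖ ≤ 1) (hzS : z ∉ S) : zeroFactor S ε z ≠ 0 := by
  rw [zeroFactor, Finset.prod_ne_zero_iff]
  intro p hp
  refine div_ne_zero (fun h => hzS ?_) (sub_one_add_mul_ne_zero (hS p hp) hε hz)
  rwa [sub_eq_zero.1 h]

theorem differentiableAt_zeroFactor (hS : ∀ p ∈ S, ‖p‖ = 1) (hε : 0 < ε) (hz : ‖z‖ ≤ 1) : DifferentiableAt ℂ (zeroFactor S ε) z := by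
  unfold zeroFactor
  refine DifferentiableAt.fun_finsetProd fun p hp => ?_
  exact DifferentiableAt.fun_div (by fun_prop) (by fun_prop)
    (sub_one_add_mul_ne_zero (hS p hp) hε hz)

theorem zeroFactor_eq_zero (hz : z ∈ S) : zeroFactor S ε z = 0 :=
  Finset.prod_eq_zero hz (by rw [sub_self, zero_div])

end ZeroFactor

/-! ### Splitting an outer function along a partition of the circle. -/

namespace LipAlgebra

variable {ω : ModulusOfContinuity}

/-- A splitting of a function `f` of the unit ball into a product of two zero-free functions whose
representing measures live on two closed sets which cover the circle and have finite
intersection. -/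
structure OuterSplitting (f : LipAlgebra ω) where
  Γ : Set ℂ
  Γ' : Set ℂ
  S : Finset ℂ
  ν : Measure ℂ
  ν' : Measure ℂ
  c : ℂ
  isFiniteMeasure : IsFiniteMeasure ν
  isFiniteMeasure' : IsFiniteMeasure ν'
  isClosed : IsClosed Γ
  isClosed' : IsClosed Γ'
  union_eq : Γ ∪ Γ' = sphere 0 1
  inter_eq : (S : Set ℂ) = Γ ∩ Γ'
  ae_mem : ∀ᵐ ξ ∂ν, ξ ∈ Γ
  ae_mem' : ∀ᵐ ξ ∂ν', ξ ∈ Γ'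
  norm_c : ‖c‖ = 1
  eq_mul : ∀ z ∈ ball (0 : ℂ) 1, lipFun f z = c * (herglotzExp ν z * herglotzExp ν' z)
  norm_le_one : ∀ z ∈ closedBall (0 : ℂ) 1, ‖lipFun f z‖ ≤ 1

namespace OuterSplitting

variable {f : LipAlgebra ω} (P : OuterSplitting f)

instance : IsFiniteMeasure P.ν := P.isFiniteMeasure

instance : IsFiniteMeasure P.ν' := P.isFiniteMeasure'

/-- The splitting with the two factors interchanged. -/
def symm : OuterSplitting f where
  Γ := P.Γ'
  Γ' := P.Γ
  S := P.S
  ν := P.ν'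
  ν' := P.ν
  c := P.c
  isFiniteMeasure := P.isFiniteMeasure'
  isFiniteMeasure' := P.isFiniteMeasure
  isClosed := P.isClosed'
  isClosed' := P.isClosed
  union_eq := by rw [union_comm, P.union_eq]
  inter_eq := by rw [inter_comm, P.inter_eq]
  ae_mem := P.ae_mem'
  ae_mem' := P.ae_mem
  norm_c := P.norm_c
  eq_mul z hz := by rw [P.eq_mul z hz, mul_comm (herglotzExp P.ν z)]
  norm_le_one := P.norm_le_one

theorem subset_sphere : P.Γ ⊆ sphere 0 1 := P.union_eq ▸ subset_union_left

theorem isCompact : IsCompact P.Γ :=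
  (isCompact_sphere 0 1).of_isClosed_subset P.isClosed P.subset_sphere

theorem norm_of_mem {p : ℂ} (hp : p ∈ P.S) : ‖p‖ = 1 := by
  have : p ∈ (P.S : Set ℂ) := hp
  rw [P.inter_eq] at this
  exact mem_sphere_zero_iff_norm.1 (P.subset_sphere this.1)

theorem mem_or_mem' {z : ℂ} (hz : ‖z‖ = 1) : z ∈ P.Γ ∨ z ∈ P.Γ' := by
  have : z ∈ P.Γ ∪ P.Γ' := P.union_eq ▸ mem_sphere_zero_iff_norm.2 hz
  exact this

theorem mem_ball_of_not_mem {z : ℂ} (hz : z ∈ closedBall (0 : ℂ) 1) (h : z ∉ P.Γ) (h' : z ∉ P.Γ') :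
    z ∈ ball (0 : ℂ) 1 := by
  rw [mem_closedBall_zero_iff] at hz
  rcases hz.lt_or_eq with hlt | heq
  · exact mem_ball_zero_iff.2 hlt
  · exact ((P.mem_or_mem' heq).elim h h').elim

theorem c_ne_zero : P.c ≠ 0 := norm_pos_iff.1 (by rw [P.norm_c]; exact one_pos)

open Classical in
/-- The factor of `f` which belongs to `Γ`, on the closed disc. -/
noncomputable def factor (z : ℂ) : ℂ :=
  if z ∈ P.Γ then lipFun f z / (P.c * herglotzExp P.ν' z) else herglotzExp P.ν z

theorem factor_of_not_mem {z : ℂ} (h : z ∉ P.Γ) : P.factor z = herglotzExp P.ν z := if_neg h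

/-- The two formulas for the factor agree inside the disc, and this one remains regular on `Γ` off
`Γ'`, where the Herglotz integral of `ν` may be singular. -/
theorem factor_of_not_mem' {z : ℂ} (hz : z ∈ closedBall (0 : ℂ) 1) (h : z ∉ P.Γ') :
    P.factor z = lipFun f z / (P.c * herglotzExp P.ν' z) := by
  by_cases hΓ : z ∈ P.Γ
  · exact if_pos hΓ
  · rw [P.factor_of_not_mem hΓ, P.eq_mul z (P.mem_ball_of_not_mem hz hΓ h)]
    have h1 := P.c_ne_zero
    have h2 := herglotzExp_ne_zero P.ν' z
    field_simp

theorem norm_herglotzExp'_eq_one {z : ℂ} (hz : ‖z‖ = 1) (h : z ∉ P.Γ') :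
    ‖herglotzExp P.ν' z‖ = 1 :=
  norm_herglotzExp_eq_one P.symm.isCompact P.symm.subset_sphere P.ae_mem' h hz

theorem norm_factor_le_one {z : ℂ} (hz : z ∈ closedBall (0 : ℂ) 1) (hS : z ∉ P.S) :
    ‖P.factor z‖ ≤ 1 := by
  by_cases hΓ : z ∈ P.Γ
  · have hΓ' : z ∉ P.Γ' := fun h' => hS (by
      have : z ∈ (P.S : Set ℂ) := by rw [P.inter_eq]; exact ⟨hΓ, h'⟩
      exact this)
    rw [P.factor_of_not_mem' hz hΓ', norm_div, norm_mul, P.norm_c, P.norm_herglotzExp'_eq_one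
      (mem_sphere_zero_iff_norm.1 (P.subset_sphere hΓ)) hΓ', one_mul, div_one]
    exact P.norm_le_one z hz
  · rw [P.factor_of_not_mem hΓ]
    exact norm_herglotzExp_le_one P.isCompact P.subset_sphere P.ae_mem hΓ
      (mem_closedBall_zero_iff.1 hz)

/-- The factor of `f` which belongs to `Γ`, multiplied by a function vanishing at the common points
of `Γ` and `Γ'`. -/
noncomputable def dampedFactor (ε : ℝ) (z : ℂ) : ℂ := zeroFactor P.S ε z ^ 2 * P.factor z

variable {ε : ℝ}

theorem norm_dampedFactor_le (ε : ℝ) {z : ℂ} (hz : z ∈ closedBall (0 : ℂ) 1) :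
    ‖P.dampedFactor ε z‖ ≤ ‖zeroFactor P.S ε z‖ ^ 2 := by
  rw [dampedFactor, norm_mul, norm_pow]
  by_cases hS : z ∈ P.S
  · rw [zeroFactor_eq_zero hS]; simp
  · exact mul_le_of_le_one_right (by positivity) (P.norm_factor_le_one hz hS)

theorem norm_dampedFactor_le_one (hε : 0 < ε) {z : ℂ} (hz : z ∈ closedBall (0 : ℂ) 1) :
    ‖P.dampedFactor ε z‖ ≤ 1 :=
  (P.norm_dampedFactor_le ε hz).trans (pow_le_one₀ (norm_nonneg _)
    (norm_zeroFactor_le_one (fun _ => P.norm_of_mem) hε (mem_closedBall_zero_iff.1 hz)))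

theorem differentiableOn_dampedFactor (hε : 0 < ε) :
    DifferentiableOn ℂ (P.dampedFactor ε) (ball 0 1) := by
  have hnot : ∀ z ∈ ball (0 : ℂ) 1, z ∉ P.Γ := fun z hz h =>
    not_mem_sphere_of_mem_ball hz (P.subset_sphere h)
  refine DifferentiableOn.congr (f := fun z => zeroFactor P.S ε z ^ 2 * herglotzExp P.ν z)
    (fun z hz => ?_) fun z hz => by rw [dampedFactor, P.factor_of_not_mem (hnot z hz)]
  refine DifferentiableAt.differentiableWithinAt (DifferentiableAt.fun_mul
    (DifferentiableAt.fun_pow (differentiableAt_zeroFactor (fun _ => P.norm_of_mem) hε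
      (mem_ball_zero_iff.1 hz).le) 2)
    (differentiableAt_herglotzExp P.isCompact P.subset_sphere P.ae_mem (hnot z hz)))

/-- Off `Γ` the exponential formula is continuous, and off `Γ'` the quotient formula is. At common
points the bound by `‖zeroFactor‖ ^ 2` forces the limit `0`. -/
theorem continuousOn_dampedFactor (hε : 0 < ε) :
    ContinuousOn (P.dampedFactor ε) (closedBall 0 1) := by
  intro z hz
  have hb : ContinuousWithinAt (zeroFactor P.S ε) (closedBall 0 1) z :=
    (differentiableAt_zeroFactor (fun _ => P.norm_of_mem) hε
      (mem_closedBall_zero_iff.1 hz)).continuousAt.continuousWithinAt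
  by_cases hΓ : z ∈ P.Γ
  · by_cases hΓ' : z ∈ P.Γ'
    · have hS : z ∈ P.S := by
        have : z ∈ (P.S : Set ℂ) := by rw [P.inter_eq]; exact ⟨hΓ, hΓ'⟩
        exact this
      have h0 : P.dampedFactor ε z = 0 := by rw [dampedFactor, zeroFactor_eq_zero hS]; simp
      rw [ContinuousWithinAt, h0]
      have h1 : Tendsto (fun w => ‖zeroFactor P.S ε w‖ ^ 2) (𝓝[closedBall 0 1] z) (𝓝 0) := by
        have : Tendsto (fun w => ‖zeroFactor P.S ε w‖ ^ 2) (𝓝[closedBall 0 1] z)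
          (𝓝 (‖zeroFactor P.S ε z‖ ^ 2)) := hb.norm.pow 2
        rwa [zeroFactor_eq_zero hS, norm_zero, zero_pow two_ne_zero] at this
      refine squeeze_zero_norm' ?_ h1
      filter_upwards [self_mem_nhdsWithin] with w hw using P.norm_dampedFactor_le ε hw
    · have hG := (differentiableAt_herglotzExp P.symm.isCompact P.symm.subset_sphere P.ae_mem'
        hΓ').continuousAt.continuousWithinAt (s := closedBall (0 : ℂ) 1)
      have h1 : ContinuousWithinAt (fun w => zeroFactor P.S ε w ^ 2 *
          (lipFun f w / (P.c * herglotzExp P.ν' w))) (closedBall 0 1) z :=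
        (hb.pow 2).mul ((continuousOn_lipFun f z hz).div (continuousWithinAt_const.mul hG)
          (mul_ne_zero P.c_ne_zero (herglotzExp_ne_zero _ _)))
      refine h1.congr_of_eventuallyEq ?_ (by rw [dampedFactor, P.factor_of_not_mem' hz hΓ'])
      filter_upwards [self_mem_nhdsWithin,
        mem_nhdsWithin_of_mem_nhds (P.isClosed'.isOpen_compl.mem_nhds hΓ')] with w hw hw'
      rw [dampedFactor, P.factor_of_not_mem' hw hw']
  · have hG := (differentiableAt_herglotzExp P.isCompact P.subset_sphere P.ae_mem
      hΓ).continuousAt.continuousWithinAt (s := closedBall (0 : ℂ) 1)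
    have h1 : ContinuousWithinAt (fun w => zeroFactor P.S ε w ^ 2 * herglotzExp P.ν w)
      (closedBall 0 1) z := (hb.pow 2).mul hG
    refine h1.congr_of_eventuallyEq ?_ (by rw [dampedFactor, P.factor_of_not_mem hΓ])
    filter_upwards [mem_nhdsWithin_of_mem_nhds (P.isClosed.isOpen_compl.mem_nhds hΓ)] with w hw
    rw [dampedFactor, P.factor_of_not_mem hw]

variable {Λ : ℝ}

theorem norm_zeroFactor_sub_le_mul (hε : 0 < ε) (hΛ : P.S.card / ε ≤ Λ) {z w : ℂ} (hz : ‖z‖ ≤ 1)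
    (hw : ‖w‖ ≤ 1) : ‖zeroFactor P.S ε z - zeroFactor P.S ε w‖ ≤ Λ * ‖z - w‖ :=
  (norm_zeroFactor_sub_le_div (fun _ => P.norm_of_mem) hε hz hw).trans (by gcongr)

/-- Between a point of `Γ` and one of `Γ'` lies a point of `S`, where `zeroFactor` vanishes. -/
theorem norm_zeroFactor_le_mul (hε : 0 < ε) (hΛ : P.S.card / ε ≤ Λ) {ξ ζ : ℂ} (hξ : ξ ∈ P.Γ)
    (hζ : ζ ∈ P.Γ') :
    ‖zeroFactor P.S ε ξ‖ ≤ Λ * ‖ξ - ζ‖ ∧ ‖zeroFactor P.S ε ζ‖ ≤ Λ * ‖ξ - ζ‖ := by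
  obtain ⟨p, hp, h1, h2⟩ := exists_mem_inter_between P.isClosed P.isClosed' P.union_eq hξ hζ
  have hΛ0 : 0 ≤ Λ := le_trans (by positivity) hΛ
  have hpS : p ∈ P.S := by
    have : p ∈ (P.S : Set ℂ) := by rw [P.inter_eq]; exact hp
    exact this
  have key : ∀ x : ℂ, ‖x‖ ≤ 1 → ‖x - p‖ ≤ ‖ξ - ζ‖ → ‖zeroFactor P.S ε x‖ ≤ Λ * ‖ξ - ζ‖ := by
    intro x hx hxp
    have := P.norm_zeroFactor_sub_le_mul hε hΛ hx (P.norm_of_mem hpS).le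
    rw [zeroFactor_eq_zero hpS, sub_zero] at this
    exact this.trans (by gcongr)
  exact ⟨key ξ (mem_sphere_zero_iff_norm.1 (P.subset_sphere hξ)).le h1,
    key ζ (mem_sphere_zero_iff_norm.1 (P.symm.subset_sphere hζ)).le h2⟩

/-- Write `b` for `zeroFactor`. Every `γ ∈ Γ` satisfies `|γ - ξ| ≥ |b ξ| / Λ`, and likewise for `ζ`,
so the factor `|b ξ| |b ζ|` cancels the singularity of the kernel difference. -/
theorem norm_zeroFactor_mul_herglotzExp_sub_le (hε : 0 < ε) (hΛ : P.S.card / ε ≤ Λ) (hΛ0 : 0 < Λ)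
    {ξ ζ : ℂ} (hξ1 : ‖ξ‖ = 1) (hζ1 : ‖ζ‖ = 1) (hξ : ξ ∉ P.Γ) (hζ : ζ ∉ P.Γ) :
    ‖zeroFactor P.S ε ξ‖ * ‖zeroFactor P.S ε ζ‖ * ‖herglotzExp P.ν ξ - herglotzExp P.ν ζ‖ ≤
      2 * P.ν.real univ * Λ ^ 2 * ‖ξ - ζ‖ := by
  set κ := ‖zeroFactor P.S ε ξ‖ * ‖zeroFactor P.S ε ζ‖ with hκ
  rcases (by positivity : 0 ≤ κ).eq_or_lt with h0 | h0
  · rw [← h0, zero_mul]; positivity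
  · have h1 := norm_herglotzExp_sub_le P.isCompact P.subset_sphere P.ae_mem hξ hζ hξ1.le hζ1.le
      (κ := κ / Λ ^ 2) (by positivity) fun γ hγ => by
        have a1 := (P.norm_zeroFactor_le_mul hε hΛ hγ ((P.mem_or_mem' hξ1).resolve_left hξ)).2
        have a2 := (P.norm_zeroFactor_le_mul hε hΛ hγ ((P.mem_or_mem' hζ1).resolve_left hζ)).2
        rw [div_le_iff₀ (by positivity)]
        calc κ ≤ (Λ * ‖γ - ξ‖) * (Λ * ‖γ - ζ‖) := by rw [hκ]; gcongr
          _ = _ := by ring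
    calc κ * ‖herglotzExp P.ν ξ - herglotzExp P.ν ζ‖
        ≤ κ * (2 * ‖ξ - ζ‖ / (κ / Λ ^ 2) * P.ν.real univ) := by gcongr
      _ = _ := by field_simp

/-- This is why the damping is squared: `b ^ 2` yields the symmetric weight `b ξ * b ζ` in front of
the difference of the factors, with one more `b` to spare in the remaining terms. -/
theorem norm_dampedFactor_sub_le_factor (hε : 0 < ε) {ξ ζ : ℂ}
    (hξ : ξ ∈ closedBall (0 : ℂ) 1) (hζ : ζ ∈ closedBall (0 : ℂ) 1) (hξS : ξ ∉ P.S)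
    (hζS : ζ ∉ P.S) :
    ‖P.dampedFactor ε ξ - P.dampedFactor ε ζ‖ ≤
      ‖zeroFactor P.S ε ξ‖ * ‖zeroFactor P.S ε ζ‖ * ‖P.factor ξ - P.factor ζ‖
        + 2 * ‖zeroFactor P.S ε ξ - zeroFactor P.S ε ζ‖ := by
  set b := zeroFactor P.S ε
  have hb : ∀ x ∈ closedBall (0 : ℂ) 1, ‖b x‖ ≤ 1 := fun x hx =>
    norm_zeroFactor_le_one (fun _ => P.norm_of_mem) hε (mem_closedBall_zero_iff.1 hx)
  have e : P.dampedFactor ε ξ - P.dampedFactor ε ζ = b ξ * b ζ * (P.factor ξ - P.factor ζ)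
      + (b ξ * P.factor ξ * (b ξ - b ζ) + b ζ * P.factor ζ * (b ξ - b ζ)) := by
    simp only [dampedFactor, b]
    ring
  have h1 : ‖b ξ * P.factor ξ‖ ≤ 1 := by
    rw [norm_mul]
    exact mul_le_one₀ (hb ξ hξ) (norm_nonneg _) (P.norm_factor_le_one hξ hξS)
  have h2 : ‖b ζ * P.factor ζ‖ ≤ 1 := by
    rw [norm_mul]
    exact mul_le_one₀ (hb ζ hζ) (norm_nonneg _) (P.norm_factor_le_one hζ hζS)
  rw [e]
  refine (norm_add_le _ _).trans (add_le_add ?_ ((norm_add_le _ _).trans ?_))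
  · rw [norm_mul, norm_mul]
  · rw [norm_mul _ (b ξ - b ζ), norm_mul _ (b ξ - b ζ), two_mul]
    exact add_le_add (mul_le_of_le_one_left (norm_nonneg _) h1)
      (mul_le_of_le_one_left (norm_nonneg _) h2)

theorem not_mem_S_of_not_mem {z : ℂ} (h : z ∉ P.Γ) : z ∉ P.S := fun hS => by
  have : z ∈ (P.S : Set ℂ) := hS
  rw [P.inter_eq] at this
  exact h this.1

/-- For points on opposite sides both values of `zeroFactor` are at most `Λ |ξ - ζ|`. If both lie
off `Γ`, only the exponential of `ν` varies. If both lie off `Γ'`, the factor is `f` divided by a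
function unimodular there, and `f` contributes its own seminorm. -/
theorem norm_dampedFactor_sub_le (hε : 0 < ε) (hΛ : P.S.card / ε ≤ Λ) (hΛ0 : 0 < Λ) {ξ ζ : ℂ}
    (hξ : ξ ∈ sphere (0 : ℂ) 1) (hζ : ζ ∈ sphere (0 : ℂ) 1) :
    ‖P.dampedFactor ε ξ - P.dampedFactor ε ζ‖ ≤ lipSeminorm f * ω ‖ξ - ζ‖ +
      (2 * (P.ν.real univ + P.ν'.real univ) * Λ ^ 2 + 2 * Λ) * ‖ξ - ζ‖ := by
  have hξ1 := mem_sphere_zero_iff_norm.1 hξ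
  have hζ1 := mem_sphere_zero_iff_norm.1 hζ
  have hξc := sphere_subset_closedBall hξ
  have hζc := sphere_subset_closedBall hζ
  have hω := mul_nonneg (lipSeminorm_nonneg f) (ω.nonneg_sphere hξ hζ)
  have hb : ∀ x ∈ closedBall (0 : ℂ) 1, ‖zeroFactor P.S ε x‖ ≤ 1 := fun x hx =>
    norm_zeroFactor_le_one (fun _ => P.norm_of_mem) hε (mem_closedBall_zero_iff.1 hx)
  have hbsub := P.norm_zeroFactor_sub_le_mul hε hΛ hξ1.le hζ1.le
  have hsep : ‖zeroFactor P.S ε ξ‖ ≤ Λ * ‖ξ - ζ‖ → ‖zeroFactor P.S ε ζ‖ ≤ Λ * ‖ξ - ζ‖ →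
      ‖P.dampedFactor ε ξ - P.dampedFactor ε ζ‖ ≤ lipSeminorm f * ω ‖ξ - ζ‖ +
      (2 * (P.ν.real univ + P.ν'.real univ) * Λ ^ 2 + 2 * Λ) * ‖ξ - ζ‖ := by
    intro h1 h2
    have a1 := P.norm_dampedFactor_le ε hξc
    have a2 := P.norm_dampedFactor_le ε hζc
    have b1 : ‖zeroFactor P.S ε ξ‖ ^ 2 ≤ ‖zeroFactor P.S ε ξ‖ :=
      pow_le_of_le_one (norm_nonneg _) (hb ξ hξc) two_ne_zero
    have b2 : ‖zeroFactor P.S ε ζ‖ ^ 2 ≤ ‖zeroFactor P.S ε ζ‖ :=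
      pow_le_of_le_one (norm_nonneg _) (hb ζ hζc) two_ne_zero
    have a3 := _root_.norm_sub_le (P.dampedFactor ε ξ) (P.dampedFactor ε ζ)
    have a4 : 0 ≤ 2 * (P.ν.real univ + P.ν'.real univ) * Λ ^ 2 * ‖ξ - ζ‖ := by positivity
    nlinarith
  by_cases hξΓ : ξ ∈ P.Γ
  · by_cases hζΓ' : ζ ∈ P.Γ'
    · have := P.norm_zeroFactor_le_mul hε hΛ hξΓ hζΓ'
      exact hsep this.1 this.2
    · have hζΓ : ζ ∈ P.Γ := (P.mem_or_mem' hζ1).resolve_right hζΓ'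
      by_cases hξΓ' : ξ ∈ P.Γ'
      · have := P.norm_zeroFactor_le_mul hε hΛ hζΓ hξΓ'
        rw [norm_sub_rev] at this
        exact hsep this.2 this.1
      · have h1 := P.norm_dampedFactor_sub_le_factor hε hξc hζc
          (P.symm.not_mem_S_of_not_mem hξΓ') (P.symm.not_mem_S_of_not_mem hζΓ')
        have h2 := P.symm.norm_zeroFactor_mul_herglotzExp_sub_le hε hΛ hΛ0 hξ1 hζ1 hξΓ' hζΓ'
        change ‖zeroFactor P.S ε ξ‖ * ‖zeroFactor P.S ε ζ‖ *
          ‖herglotzExp P.ν' ξ - herglotzExp P.ν' ζ‖ ≤ 2 * P.ν'.real univ * Λ ^ 2 * ‖ξ - ζ‖ at h2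
        have n1 := P.norm_herglotzExp'_eq_one hξ1 hξΓ'
        have n2 := P.norm_herglotzExp'_eq_one hζ1 hζΓ'
        have h3 : ‖P.factor ξ - P.factor ζ‖ ≤ lipSeminorm f * ω ‖ξ - ζ‖ +
            ‖herglotzExp P.ν' ξ - herglotzExp P.ν' ζ‖ := by
          have hc := P.c_ne_zero
          have g1 := herglotzExp_ne_zero P.ν' ξ
          have g2 := herglotzExp_ne_zero P.ν' ζ
          have e : P.factor ξ - P.factor ζ = ((lipFun f ξ - lipFun f ζ) / herglotzExp P.ν' ξ -
              lipFun f ζ * (herglotzExp P.ν' ξ - herglotzExp P.ν' ζ) /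
                (herglotzExp P.ν' ξ * herglotzExp P.ν' ζ)) / P.c := by
            rw [P.factor_of_not_mem' hξc hξΓ', P.factor_of_not_mem' hζc hζΓ']
            field_simp
            ring
          rw [e, norm_div, P.norm_c, div_one]
          refine (_root_.norm_sub_le _ _).trans (add_le_add ?_ ?_)
          · rw [norm_div, n1, div_one]
            exact norm_lipFun_sub_le f hξ hζ
          · rw [norm_div, norm_mul, norm_mul, n1, n2, mul_one, div_one]
            exact mul_le_of_le_one_left (norm_nonneg _) (P.norm_le_one ζ hζc)
        have h4 : ‖zeroFactor P.S ε ξ‖ * ‖zeroFactor P.S ε ζ‖ ≤ 1 :=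
          mul_le_one₀ (hb ξ hξc) (norm_nonneg _) (hb ζ hζc)
        have h5 : ‖zeroFactor P.S ε ξ‖ * ‖zeroFactor P.S ε ζ‖ * ‖P.factor ξ - P.factor ζ‖ ≤
            lipSeminorm f * ω ‖ξ - ζ‖ + 2 * P.ν'.real univ * Λ ^ 2 * ‖ξ - ζ‖ :=
          calc _ ≤ ‖zeroFactor P.S ε ξ‖ * ‖zeroFactor P.S ε ζ‖ * (lipSeminorm f * ω ‖ξ - ζ‖ +
                ‖herglotzExp P.ν' ξ - herglotzExp P.ν' ζ‖) := by gcongr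
            _ = ‖zeroFactor P.S ε ξ‖ * ‖zeroFactor P.S ε ζ‖ * (lipSeminorm f * ω ‖ξ - ζ‖) +
                ‖zeroFactor P.S ε ξ‖ * ‖zeroFactor P.S ε ζ‖ *
                ‖herglotzExp P.ν' ξ - herglotzExp P.ν' ζ‖ := by ring
            _ ≤ _ := add_le_add (mul_le_of_le_one_left hω h4) h2
        have h6 : 0 ≤ 2 * P.ν.real univ * Λ ^ 2 * ‖ξ - ζ‖ := by positivity
        nlinarith
  · have hξΓ' : ξ ∈ P.Γ' := (P.mem_or_mem' hξ1).resolve_left hξΓ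
    by_cases hζΓ : ζ ∈ P.Γ
    · have := P.norm_zeroFactor_le_mul hε hΛ hζΓ hξΓ'
      rw [norm_sub_rev] at this
      exact hsep this.2 this.1
    · have h1 := P.norm_dampedFactor_sub_le_factor hε hξc hζc
        (P.not_mem_S_of_not_mem hξΓ) (P.not_mem_S_of_not_mem hζΓ)
      have h2 := P.norm_zeroFactor_mul_herglotzExp_sub_le hε hΛ hΛ0 hξ1 hζ1 hξΓ hζΓ
      rw [P.factor_of_not_mem hξΓ, P.factor_of_not_mem hζΓ] at h1
      have h6 : 0 ≤ 2 * P.ν'.real univ * Λ ^ 2 * ‖ξ - ζ‖ := by positivity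
      nlinarith

/-- The constant involves only the mass of `ν` on `Γ` and `S.card * ε`; both become small as the
partition is refined, which gives convergence off `E`. -/
theorem norm_dampedFactor_sub_le_of_dist (hε : 0 < ε) {z w : ℂ} (hz : z ∈ closedBall (0 : ℂ) 1)
    (hw : w ∈ closedBall (0 : ℂ) 1) {r s : ℝ} (hr : 0 < r) (hs : 0 < s)
    (hzr : ∀ γ ∈ P.Γ, r ≤ ‖γ - z‖) (hws : ∀ γ ∈ P.Γ, s ≤ ‖γ - w‖) :
    ‖P.dampedFactor ε z - P.dampedFactor ε w‖ ≤
      (2 * P.ν.real univ + 2 * (P.S.card * ε)) * ‖z - w‖ / (r * s) := by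
  have hzΓ : z ∉ P.Γ := fun h => by
    have := hzr z h
    rw [sub_self, norm_zero] at this
    linarith
  have hwΓ : w ∉ P.Γ := fun h => by
    have := hws w h
    rw [sub_self, norm_zero] at this
    linarith
  have hz1 := mem_closedBall_zero_iff.1 hz
  have hw1 := mem_closedBall_zero_iff.1 hw
  have h1 := P.norm_dampedFactor_sub_le_factor hε hz hw (P.not_mem_S_of_not_mem hzΓ)
    (P.not_mem_S_of_not_mem hwΓ)
  rw [P.factor_of_not_mem hzΓ, P.factor_of_not_mem hwΓ] at h1
  have h2 := norm_herglotzExp_sub_le P.isCompact P.subset_sphere P.ae_mem hzΓ hwΓ hz1 hw1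
    (mul_pos hr hs) fun γ hγ => mul_le_mul (hzr γ hγ) (hws γ hγ) hs.le (norm_nonneg _)
  have hS : ∀ p ∈ P.S, p ∈ P.Γ := fun p hp => by
    have : p ∈ (P.S : Set ℂ) := hp
    rw [P.inter_eq] at this
    exact this.1
  have h3 := norm_zeroFactor_sub_le (S := P.S) (fun _ => P.norm_of_mem) hε hz1 hw1
    (mul_pos hr hs) fun p hp => mul_le_mul
      (((hzr p (hS p hp)).trans_eq (norm_sub_rev _ _)).trans
        (norm_sub_le_norm_sub_one_add_mul (P.norm_of_mem hp) hε.le hz1))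
      (((hws p (hS p hp)).trans_eq (norm_sub_rev _ _)).trans
        (norm_sub_le_norm_sub_one_add_mul (P.norm_of_mem hp) hε.le hw1)) hs.le (norm_nonneg _)
  have h4 : ‖zeroFactor P.S ε z‖ * ‖zeroFactor P.S ε w‖ ≤ 1 :=
    mul_le_one₀ (norm_zeroFactor_le_one (fun _ => P.norm_of_mem) hε hz1) (norm_nonneg _)
      (norm_zeroFactor_le_one (fun _ => P.norm_of_mem) hε hw1)
  have h5 := mul_le_of_le_one_left (norm_nonneg (herglotzExp P.ν z - herglotzExp P.ν w)) h4
  have e : (2 * P.ν.real univ + 2 * (P.S.card * ε)) * ‖z - w‖ / (r * s) =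
    2 * ‖z - w‖ / (r * s) * P.ν.real univ + 2 * (P.S.card * ε * ‖z - w‖ / (r * s)) := by ring
  linarith

theorem norm_one_sub_dampedFactor_le (hε : 0 < ε) {z : ℂ} (hz : z ∈ closedBall (0 : ℂ) 1) {r : ℝ}
    (hr : 0 < r) (hzr : ∀ γ ∈ P.Γ, r ≤ ‖γ - z‖) :
    ‖1 - P.dampedFactor ε z‖ ≤ (2 * P.ν.real univ + 2 * (P.S.card * ε)) / r := by
  have hzΓ : z ∉ P.Γ := fun h => by
    have := hzr z h
    rw [sub_self, norm_zero] at this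
    linarith
  have hz1 := mem_closedBall_zero_iff.1 hz
  have hS : ∀ p ∈ P.S, p ∈ P.Γ := fun p hp => by
    have : p ∈ (P.S : Set ℂ) := hp
    rw [P.inter_eq] at this
    exact this.1
  have hb := norm_zeroFactor_le_one (S := P.S) (fun _ => P.norm_of_mem) hε hz1
  have h1 := norm_one_sub_zeroFactor_le (S := P.S) (fun _ => P.norm_of_mem) hε hz1 hr
    fun p hp => hzr p (hS p hp)
  have h2 := norm_one_sub_herglotzExp_le P.isCompact P.subset_sphere P.ae_mem hzΓ hz1 hr hzr
  set b := zeroFactor P.S ε z with hb_def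
  have e : 1 - P.dampedFactor ε z =
      ((1 - b) + b * (1 - b)) + b ^ 2 * (1 - herglotzExp P.ν z) := by
    rw [dampedFactor, P.factor_of_not_mem hzΓ, ← hb_def]
    ring
  have e' : (2 * P.ν.real univ + 2 * (P.S.card * ε)) / r =
    (P.S.card * ε / r + P.S.card * ε / r) + 2 / r * P.ν.real univ := by ring
  rw [e, e']
  refine (norm_add_le _ _).trans (add_le_add ((norm_add_le _ _).trans (add_le_add h1 ?_)) ?_)
  · rw [norm_mul]
    exact (mul_le_of_le_one_left (norm_nonneg _) hb).trans h1
  · rw [norm_mul, norm_pow]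
    exact (mul_le_of_le_one_left (norm_nonneg _) (pow_le_one₀ (norm_nonneg _) hb)).trans h2

theorem dampedFactor_ne_zero (hε : 0 < ε) {z : ℂ} (hz : z ∈ closedBall (0 : ℂ) 1) (h : z ∉ P.Γ) :
    P.dampedFactor ε z ≠ 0 := by
  rw [dampedFactor, P.factor_of_not_mem h]
  exact mul_ne_zero (pow_ne_zero 2 (zeroFactor_ne_zero (fun _ => P.norm_of_mem) hε
    (mem_closedBall_zero_iff.1 hz) (P.not_mem_S_of_not_mem h))) (herglotzExp_ne_zero _ _)

theorem dampedFactor_mul_symm (ε : ℝ) {z : ℂ} (hz : z ∈ closedBall (0 : ℂ) 1) :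
    P.dampedFactor ε z * P.symm.dampedFactor ε z = P.c⁻¹ * zeroFactor P.S ε z ^ 4 * lipFun f z := by
  have hc := P.c_ne_zero
  have key : ∀ P : OuterSplitting f, z ∉ P.Γ →
      P.dampedFactor ε z * P.symm.dampedFactor ε z =
        P.c⁻¹ * zeroFactor P.S ε z ^ 4 * lipFun f z := by
    intro P hΓ
    have hc := P.c_ne_zero
    have e : P.symm.factor z = lipFun f z / (P.c * herglotzExp P.ν z) :=
      P.symm.factor_of_not_mem' hz hΓ
    have hS : P.symm.S = P.S := rfl
    have hG := herglotzExp_ne_zero P.ν z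
    rw [dampedFactor, dampedFactor, P.factor_of_not_mem hΓ, e, hS]
    field_simp
  by_cases hΓ : z ∈ P.Γ
  · by_cases hΓ' : z ∈ P.Γ'
    · have hS : z ∈ P.S := by
        have : z ∈ (P.S : Set ℂ) := by rw [P.inter_eq]; exact ⟨hΓ, hΓ'⟩
        exact this
      simp [dampedFactor, zeroFactor_eq_zero hS]
    · have := key P.symm hΓ'
      rw [mul_comm]
      exact this
  · exact key P hΓ

theorem exists_lipFun_eq_dampedFactor (hε : 0 < ε) :
    ∃ V : LipAlgebra ω, ∀ z ∈ closedBall (0 : ℂ) 1, lipFun V z = P.dampedFactor ε z := by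
  have hω2 : 0 < ω 2 := ω.pos two_pos le_rfl
  -- The summand `1` keeps `Λ` positive when `S` is empty.
  obtain ⟨Λ, hΛ⟩ : ∃ Λ : ℝ, Λ = P.S.card / ε + 1 := ⟨_, rfl⟩
  have hΛ0 : 0 < Λ := by rw [hΛ]; positivity
  set C := 2 * (P.ν.real univ + P.ν'.real univ) * Λ ^ 2 + 2 * Λ
  have hC : 0 ≤ C := by positivity
  refine exists_lipFun_eq ω (P.continuousOn_dampedFactor hε) (P.differentiableOn_dampedFactor hε)
    (a := lipSeminorm f + C * (2 / ω 2)) (add_nonneg (lipSeminorm_nonneg f) (by positivity))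
    fun ξ hξ ζ hζ => ?_
  refine (P.norm_dampedFactor_sub_le hε (by linarith) hΛ0 hξ hζ).trans
    (?_ : lipSeminorm f * ω ‖ξ - ζ‖ + C * ‖ξ - ζ‖ ≤ _)
  rw [add_mul (lipSeminorm f)]
  refine add_le_add le_rfl ?_
  have := ω.mul_le (norm_nonneg (ξ - ζ)) (norm_sub_le_two_of_sphere hξ hζ)
  calc C * ‖ξ - ζ‖ = C * (2 / ω 2) * (ω 2 / 2 * ‖ξ - ζ‖) := by field_simp
    _ ≤ _ := by gcongr

theorem exists_lipFun_eq_zeroFactor (hε : 0 < ε) :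
    ∃ B : LipAlgebra ω, ∀ z ∈ closedBall (0 : ℂ) 1, lipFun B z = zeroFactor P.S ε z := by
  have hω2 : 0 < ω 2 := ω.pos two_pos le_rfl
  have hd : ∀ z ∈ closedBall (0 : ℂ) 1, DifferentiableAt ℂ (zeroFactor P.S ε) z := fun z hz =>
    differentiableAt_zeroFactor (fun _ => P.norm_of_mem) hε (mem_closedBall_zero_iff.1 hz)
  refine exists_lipFun_eq ω (fun z hz => (hd z hz).continuousAt.continuousWithinAt)
    (fun z hz => (hd z (ball_subset_closedBall hz)).differentiableWithinAt)
    (a := P.S.card / ε * (2 / ω 2)) (by positivity) fun ξ hξ ζ hζ => ?_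
  refine (norm_zeroFactor_sub_le_div (fun _ => P.norm_of_mem) hε
    (mem_sphere_zero_iff_norm.1 hξ).le (mem_sphere_zero_iff_norm.1 hζ).le).trans ?_
  have := ω.mul_le (norm_nonneg (ξ - ζ)) (norm_sub_le_two_of_sphere hξ hζ)
  calc P.S.card / ε * ‖ξ - ζ‖ = P.S.card / ε * (2 / ω 2) * (ω 2 / 2 * ‖ξ - ζ‖) := by
        field_simp
    _ ≤ _ := by gcongr

/-- The product of the two damped factors is a multiple of `f`, hence in `K`. The one for `Γ'`
vanishes at most on `Γ'`, where `K` has no common zeros, so it can be cancelled. -/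
theorem exists_mem_lipFun_eq_dampedFactor (hε : 0 < ε) {K : Ideal (LipAlgebra ω)} (hf : f ∈ K)
    (hK : ∀ w ∈ closedBall (0 : ℂ) 1, (∀ k ∈ K, lipFun k w = 0) → w ∉ P.Γ') :
    ∃ V ∈ K, ∀ z ∈ closedBall (0 : ℂ) 1, lipFun V z = P.dampedFactor ε z := by
  obtain ⟨V, hV⟩ := P.exists_lipFun_eq_dampedFactor hε
  obtain ⟨V', hV'⟩ := P.symm.exists_lipFun_eq_dampedFactor hε
  obtain ⟨B, hB⟩ := P.exists_lipFun_eq_zeroFactor hε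
  refine ⟨V, mem_of_mul_mem_of_forall_ne_zero (v := V') ?_ fun w hw h => ?_, hV⟩
  · have : V * V' = algebraMap ℂ _ P.c⁻¹ * (B * B * (B * B)) * f := ext_lipFun fun z hz => by
      simp only [lipFun_mul, lipFun_algebraMap _ hz, hB z hz, hV z hz, hV' z hz,
        P.dampedFactor_mul_symm ε hz]
      ring
    rw [this]
    exact K.mul_mem_left _ hf
  · rw [hV' w hw]
    exact P.symm.dampedFactor_ne_zero hε hw (hK w hw h)

end OuterSplitting

end LipAlgebra

/-! ### Approximate units: the weighted estimate and norm convergence. -/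

/-- Up to constants `ω (2 * s)` is at most `ω (s ^ 8)`. If `t ≥ s ^ 8`, this is at most `ω t` and `D
≤ 2` suffices; if `t < s ^ 8`, the monotonicity of `ω t / t` gives `(t / s ^ 8) * ω (s ^ 8) ≤ ω t`.
-/
theorem ModulusOfContinuity.mul_le_of_le_two (ω : ModulusOfContinuity) (hω : 0 < ω.eta)
    {s t D L C : ℝ} (hs0 : 0 < s) (hs1 : s ≤ 1) (ht0 : 0 ≤ t) (ht2 : t ≤ 2) (hL : 0 ≤ L)
    (hC : 0 ≤ C) (hD2 : D ≤ 2) (hD : D ≤ L * ω t + C * (t / s ^ 8)) :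
    D * ω (2 * s) ≤ (L * ω 2 + (4 + 2 * C) / ω.eta ^ 3) * ω t := by
  have hη : 0 < ω.eta ^ 3 := pow_pos hω 3
  have hs8 : 0 < s ^ 8 := pow_pos hs0 8
  have hs81 : s ^ 8 ≤ 1 := pow_le_one₀ hs0.le hs1
  have hωt : 0 ≤ ω t := ω.nonneg' t ⟨ht0, ht2⟩
  have hω2 : 0 < ω 2 := ω.pos two_pos le_rfl
  have hω2s : 0 < ω (2 * s) := ω.pos (by linarith) (by linarith)
  have hω2s' : ω (2 * s) ≤ ω 2 := ω.le_of_le (by linarith) (by linarith) le_rfl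
  have h1 : ω (2 * s) ≤ 2 * ω s := by
    have := ω.le_two_mul_half (t := 2 * s) (by linarith) (by linarith)
    rwa [mul_div_cancel_left₀ s two_ne_zero] at this
  have h2 : ω s ≤ ω (s ^ 8) / ω.eta ^ 3 := by
    rw [le_div_iff₀ hη, mul_comm]
    exact ω.eta_pow_three_mul_le hω hs0 hs1
  have h3 : ω (2 * s) ≤ 2 / ω.eta ^ 3 * ω (s ^ 8) := by
    calc ω (2 * s) ≤ 2 * (ω (s ^ 8) / ω.eta ^ 3) := h1.trans (by linarith)
      _ = _ := by ring
  have hpos : 0 ≤ 2 / ω.eta ^ 3 := by positivity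
  rcases le_or_gt (s ^ 8) t with h | h
  · have h4 : ω (s ^ 8) ≤ ω t := ω.le_of_le hs8.le h ht2
    calc D * ω (2 * s) ≤ 2 * (2 / ω.eta ^ 3 * ω t) := by
          refine mul_le_mul hD2 (h3.trans ?_) hω2s.le two_pos.le
          gcongr
      _ = 4 / ω.eta ^ 3 * ω t := by ring
      _ ≤ (L * ω 2 + (4 + 2 * C) / ω.eta ^ 3) * ω t := by
          gcongr
          have a1 : 4 / ω.eta ^ 3 ≤ (4 + 2 * C) / ω.eta ^ 3 := by gcongr; linarith
          have a2 : 0 ≤ L * ω 2 := by positivity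
          linarith
  · have h5 : t * ω (s ^ 8) ≤ s ^ 8 * ω t := by
      rcases ht0.eq_or_lt with rfl | ht0
      · simp [ω.zero']
      · have := ω.div_le_div ht0 h.le (hs81.trans one_le_two)
        rw [div_le_div_iff₀ hs8 ht0] at this
        linarith
    have h6 : t / s ^ 8 * ω (s ^ 8) ≤ ω t := by
      rw [div_mul_eq_mul_div, div_le_iff₀ hs8]
      linarith
    calc D * ω (2 * s) ≤ (L * ω t + C * (t / s ^ 8)) * ω (2 * s) := by gcongr
      _ = L * ω t * ω (2 * s) + C * (t / s ^ 8) * ω (2 * s) := by ring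
      _ ≤ L * ω t * ω 2 + C * (t / s ^ 8) * (2 / ω.eta ^ 3 * ω (s ^ 8)) := by gcongr
      _ = L * ω 2 * ω t + C * (2 / ω.eta ^ 3) * (t / s ^ 8 * ω (s ^ 8)) := by ring
      _ ≤ L * ω 2 * ω t + C * (2 / ω.eta ^ 3) * ω t := by gcongr
      _ ≤ (L * ω 2 + (4 + 2 * C) / ω.eta ^ 3) * ω t := by
          have : 0 ≤ 4 / ω.eta ^ 3 * ω t := by positivity
          have e : (4 + 2 * C) / ω.eta ^ 3 = 4 / ω.eta ^ 3 + C * (2 / ω.eta ^ 3) := by ring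
          rw [e]
          linarith

theorem infDist_le_two_of_sphere {E : Set ℂ} (hE1 : E ⊆ sphere 0 1) (hne : E.Nonempty) {ξ : ℂ}
    (hξ : ξ ∈ sphere (0 : ℂ) 1) : infDist ξ E ≤ 2 := by
  obtain ⟨e, he⟩ := hne
  refine (infDist_le_dist_of_mem he).trans ?_
  rw [dist_eq_norm]
  exact norm_sub_le_two_of_sphere hξ (hE1 he)

namespace LipAlgebra

variable {ω : ModulusOfContinuity}

theorem isClosed_hull (I : Ideal (LipAlgebra ω)) : IsClosed (hull I) := by
  have : hull I = ⋂ f ∈ I, sphere (0 : ℂ) 1 ∩ lipFun f ⁻¹' {0} := by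
    ext ξ
    simp only [hull, mem_ofPred_eq, mem_iInter, mem_inter_iff, mem_preimage, mem_singleton_iff]
    exact ⟨fun h f hf => ⟨h.1, h.2 f hf⟩, fun h => ⟨(h 0 I.zero_mem).1, fun f hf => (h f hf).2⟩⟩
  rw [this]
  exact isClosed_biInter fun f _ => ((continuousOn_lipFun f).mono
    sphere_subset_closedBall).preimage_isClosed_of_isClosed isClosed_sphere isClosed_singleton

/-- A function of the small space of `E` is approximated by its products with functions which tend
to `1` off `E` and are equicontinuous in a suitable weighted sense. -/
theorem mem_of_approximate_unit {I : Ideal (LipAlgebra ω)} (hI : IsNormClosed I) {E : Set ℂ}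
    (hE : IsClosed E) (hE1 : E ⊆ sphere 0 1) (hne : E.Nonempty) {g : LipAlgebra ω}
    (hg : g ∈ smallSpace ω E) {V : ℕ → LipAlgebra ω} (hV : ∀ n, g * V n ∈ I)
    (hV1 : ∀ n, ∀ z ∈ closedBall (0 : ℂ) 1, ‖lipFun (V n) z‖ ≤ 1) {C : ℝ} (hC : 0 ≤ C)
    (hVC : ∀ n, ∀ ξ ∈ sphere (0 : ℂ) 1, ξ ∉ E → ∀ ζ ∈ sphere (0 : ℂ) 1,
      ‖lipFun (V n) ξ - lipFun (V n) ζ‖ * ω (infDist ξ E) ≤ C * ω ‖ξ - ζ‖)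
    (hlim : ∀ δ > 0, ∀ τ > 0, ∀ᶠ n in atTop, ∀ ξ ∈ sphere (0 : ℂ) 1, δ ≤ infDist ξ E →
      ‖1 - lipFun (V n) ξ‖ ≤ τ ∧ ∀ ζ ∈ sphere (0 : ℂ) 1, δ ≤ infDist ζ E →
        ‖lipFun (V n) ξ - lipFun (V n) ζ‖ ≤ τ * ω ‖ξ - ζ‖) : g ∈ I := by
  have hEc : IsCompact E := (isCompact_sphere 0 1).of_isClosed_subset hE hE1
  have hω2 : 0 < ω 2 := ω.pos two_pos le_rfl
  refine hI g fun ε hε => ?_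
  set N := supNorm g
  set L := lipSeminorm g
  have hN : 0 ≤ N := supNorm_nonneg g
  have hL : 0 ≤ L := lipSeminorm_nonneg g
  -- `Q` adds the constants of the supremum and seminorm estimates below, so that the total is `Q *
  -- τ = ε / 2`.
  obtain ⟨Q, hQ⟩ : ∃ Q, Q = (2 * ω 2 + N) + (N + L + C + 2) := ⟨_, rfl⟩
  have hQ0 : 0 < Q := by rw [hQ]; positivity
  obtain ⟨τ, hτ⟩ : ∃ τ, τ = ε / (2 * Q) := ⟨_, rfl⟩
  have hτ0 : 0 < τ := by rw [hτ]; positivity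
  obtain ⟨δ₀, hδ₀, hsmall⟩ := hg.2 τ hτ0
  have hgd : ∀ ξ ∈ sphere (0 : ℂ) 1, ∀ ζ ∈ sphere (0 : ℂ) 1, infDist ξ E ≤ δ₀ → infDist ζ E ≤ δ₀ →
      ‖lipFun g ξ - lipFun g ζ‖ ≤ τ * ω ‖ξ - ζ‖ := by
    intro ξ hξ ζ hζ hdξ hdζ
    by_cases hξζ : ξ = ζ
    · simp [hξζ, ω.zero']
    have mem : ∀ x ∈ sphere (0 : ℂ) 1, infDist x E ≤ δ₀ → x ∈ circleNhd E δ₀ := by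
      intro x hx hd
      obtain ⟨e, he, hxe⟩ := hEc.exists_infDist_eq_dist hne x
      exact ⟨hx, mem_cthickening_of_dist_le x e δ₀ E he (hxe ▸ hd)⟩
    have := hsmall _ ⟨ξ, mem ξ hξ hdξ, ζ, mem ζ hζ hdζ, hξζ, rfl⟩
    rwa [div_le_iff₀ (ω.pos (norm_pos_iff.2 (sub_ne_zero.2 hξζ))
      (norm_sub_le_two_of_sphere hξ hζ))] at this
  -- Compare `ξ` with a nearest point of `E`, where `g` vanishes.
  have hgE : ∀ ξ ∈ sphere (0 : ℂ) 1, infDist ξ E ≤ δ₀ → ‖lipFun g ξ‖ ≤ τ * ω (infDist ξ E) := by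
    intro ξ hξ hd
    obtain ⟨e, he, hxe⟩ := hEc.exists_infDist_eq_dist hne ξ
    have := hgd ξ hξ e (hE1 he) hd (by rw [infDist_zero_of_mem he]; exact hδ₀.le)
    rwa [hg.1 e he, sub_zero, ← dist_eq_norm, ← hxe] at this
  obtain ⟨n, hn⟩ := (hlim (δ₀ / 2) (half_pos hδ₀) τ hτ0).exists
  have hw2 : ∀ z ∈ closedBall (0 : ℂ) 1, ‖1 - lipFun (V n) z‖ ≤ 2 := fun z hz => by
    refine (_root_.norm_sub_le _ _).trans ?_
    rw [norm_one]
    linarith [hV1 n z hz]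
  have hgN : ∀ z ∈ sphere (0 : ℂ) 1, ‖lipFun g z‖ ≤ N := fun z hz =>
    norm_lipFun_le g (sphere_subset_closedBall hz)
  have hfun : ∀ z ∈ closedBall (0 : ℂ) 1, lipFun (g - g * V n) z =
      lipFun g z * (1 - lipFun (V n) z) := fun z hz => by
    rw [lipFun_sub, lipFun_mul]; ring
  refine ⟨g * V n, hV n, ?_⟩
  have hsup : supNorm (g - g * V n) ≤ (2 * ω 2 + N) * τ := supNorm_le_of_sphere fun ξ hξ => by
    have hξc := sphere_subset_closedBall hξ
    rw [hfun ξ hξc, norm_mul]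
    rcases le_or_gt (δ₀ / 2) (infDist ξ E) with hd | hd
    · calc ‖lipFun g ξ‖ * ‖1 - lipFun (V n) ξ‖ ≤ N * τ :=
          mul_le_mul (hgN ξ hξ) (hn ξ hξ hd).1 (norm_nonneg _) hN
        _ ≤ _ := by
          have : 0 ≤ 2 * ω 2 * τ := by positivity
          linarith
    · have h1 := hgE ξ hξ (by linarith)
      have h2 : ω (infDist ξ E) ≤ ω 2 :=
        ω.le_of_le infDist_nonneg (infDist_le_two_of_sphere hE1 hne hξ) le_rfl
      calc ‖lipFun g ξ‖ * ‖1 - lipFun (V n) ξ‖ ≤ (τ * ω 2) * 2 :=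
          mul_le_mul (h1.trans (by gcongr)) (hw2 ξ hξc) (norm_nonneg _) (by positivity)
        _ ≤ _ := by
          have : 0 ≤ N * τ := by positivity
          linarith
  -- The variation of `V n` is multiplied by `g` at `ξ`, so for `ξ` near `E` the bound `|g ξ| ≤ τ
  -- ω(d(ξ, E))` provides the weight in `hVC`. If only `ζ` is near, the roles are exchanged.
  have hdiff : ∀ ξ ∈ sphere (0 : ℂ) 1, ∀ ζ ∈ sphere (0 : ℂ) 1,
      lipFun (g - g * V n) ξ - lipFun (g - g * V n) ζ =
        -(lipFun g ξ * (lipFun (V n) ξ - lipFun (V n) ζ)) +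
          (1 - lipFun (V n) ζ) * (lipFun g ξ - lipFun g ζ) := fun ξ hξ ζ hζ => by
    rw [hfun ξ (sphere_subset_closedBall hξ), hfun ζ (sphere_subset_closedBall hζ)]
    ring
  have hnear : ∀ ξ ∈ sphere (0 : ℂ) 1, ∀ ζ ∈ sphere (0 : ℂ) 1, infDist ξ E < δ₀ / 2 →
      ‖lipFun (g - g * V n) ξ - lipFun (g - g * V n) ζ‖ ≤ (N + L + C + 2) * τ * ω ‖ξ - ζ‖ := by
    intro ξ hξ ζ hζ hd
    have hωt := ω.nonneg_sphere hξ hζ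
    have h1 : ‖lipFun g ξ * (lipFun (V n) ξ - lipFun (V n) ζ)‖ ≤ C * τ * ω ‖ξ - ζ‖ := by
      by_cases hξE : ξ ∈ E
      · rw [hg.1 ξ hξE, zero_mul, norm_zero]
        positivity
      · rw [norm_mul]
        calc ‖lipFun g ξ‖ * ‖lipFun (V n) ξ - lipFun (V n) ζ‖
            ≤ (τ * ω (infDist ξ E)) * ‖lipFun (V n) ξ - lipFun (V n) ζ‖ := by
              gcongr
              exact hgE ξ hξ (by linarith)
          _ = τ * (‖lipFun (V n) ξ - lipFun (V n) ζ‖ * ω (infDist ξ E)) := by ring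
          _ ≤ τ * (C * ω ‖ξ - ζ‖) := mul_le_mul_of_nonneg_left (hVC n ξ hξ hξE ζ hζ) hτ0.le
          _ = _ := by ring
    have h2 : ‖(1 - lipFun (V n) ζ) * (lipFun g ξ - lipFun g ζ)‖ ≤ (L + 2) * τ * ω ‖ξ - ζ‖ := by
      rw [norm_mul]
      rcases le_or_gt (δ₀ / 2) (infDist ζ E) with hd' | hd'
      · calc _ ≤ τ * (L * ω ‖ξ - ζ‖) := mul_le_mul (hn ζ hζ hd').1 (norm_lipFun_sub_le g hξ hζ)
              (norm_nonneg _) hτ0.le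
          _ ≤ _ := by
              have : 0 ≤ 2 * τ * ω ‖ξ - ζ‖ := by positivity
              linarith
      · calc _ ≤ 2 * (τ * ω ‖ξ - ζ‖) := mul_le_mul (hw2 ζ (sphere_subset_closedBall hζ))
              (hgd ξ hξ ζ hζ (by linarith) (by linarith)) (norm_nonneg _) two_pos.le
          _ ≤ _ := by
              have : 0 ≤ L * τ * ω ‖ξ - ζ‖ := by positivity
              linarith
    rw [hdiff ξ hξ ζ hζ]
    refine (norm_add_le _ _).trans ?_
    rw [norm_neg]
    have h3 : 0 ≤ N * τ * ω ‖ξ - ζ‖ := by positivity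
    linarith
  have hlip : lipSeminorm (g - g * V n) ≤ (N + L + C + 2) * τ :=
    lipSeminorm_le (by positivity) fun ξ hξ ζ hζ => by
      rcases lt_or_ge (infDist ξ E) (δ₀ / 2) with hd | hd
      · exact hnear ξ hξ ζ hζ hd
      rcases lt_or_ge (infDist ζ E) (δ₀ / 2) with hd' | hd'
      · rw [norm_sub_rev, norm_sub_rev ξ]
        exact hnear ζ hζ ξ hξ hd'
      have hωt := ω.nonneg_sphere hξ hζ
      rw [hdiff ξ hξ ζ hζ]
      refine (norm_add_le _ _).trans ?_
      rw [norm_neg, norm_mul, norm_mul]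
      have h1 : ‖lipFun g ξ‖ * ‖lipFun (V n) ξ - lipFun (V n) ζ‖ ≤ N * (τ * ω ‖ξ - ζ‖) :=
        mul_le_mul (hgN ξ hξ) ((hn ξ hξ hd).2 ζ hζ hd') (norm_nonneg _) hN
      have h2 : ‖1 - lipFun (V n) ζ‖ * ‖lipFun g ξ - lipFun g ζ‖ ≤ τ * (L * ω ‖ξ - ζ‖) :=
        mul_le_mul (hn ζ hζ hd').1 (norm_lipFun_sub_le g hξ hζ) (norm_nonneg _) hτ0.le
      have h3 : 0 ≤ C * τ * ω ‖ξ - ζ‖ := by positivity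
      have h4 : 0 ≤ 2 * τ * ω ‖ξ - ζ‖ := by positivity
      linarith
  rw [lipNorm_eq]
  calc _ ≤ (2 * ω 2 + N) * τ + (N + L + C + 2) * τ := add_le_add hsup hlip
    _ = Q * τ := by rw [hQ]; ring
    _ = ε / 2 := by rw [hτ]; field_simp
    _ < ε := half_lt_self hε

theorem exists_outerSplitting {f : LipAlgebra ω} (hf1 : ∀ z ∈ closedBall (0 : ℂ) 1, ‖lipFun f z‖ ≤ 1)
    {ν : Measure ℂ} [IsFiniteMeasure ν] (hν : ∀ᵐ ξ ∂ν, ξ ∈ sphere (0 : ℂ) 1) {c : ℂ} (hc : ‖c‖ = 1)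
    (hfν : ∀ z ∈ ball (0 : ℂ) 1, lipFun f z = c * herglotzExp ν z) (E : Set ℂ) {M : ℕ}
    (hM : 0 < M) :
    ∃ P : OuterSplitting f, P.S.card ≤ M ∧ (∀ x ∈ P.Γ', x ∉ E) ∧
      (∀ x ∈ P.Γ, ∃ e ∈ E, ‖x - e‖ ≤ 8 / M) ∧
      P.ν.real univ ≤ ν.real (cthickening (8 / M) E) ∧
      P.ν.real univ + P.ν'.real univ = ν.real univ := by
  obtain ⟨Γ, Γ', S, hΓ, hΓ', hcover, hS, hcard, hfar, hnear⟩ := exists_circle_partition E hM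
  refine ⟨
    { Γ := Γ
      Γ' := Γ'
      S := S
      ν := ν.restrict Γ
      -- The complement of `Γ` is used instead of `Γ'` so that mass at common points is not counted
      -- twice.
      ν' := ν.restrict Γᶜ
      c := c
      isFiniteMeasure := inferInstance
      isFiniteMeasure' := inferInstance
      isClosed := hΓ
      isClosed' := hΓ'
      union_eq := hcover
      inter_eq := hS
      ae_mem := ae_restrict_mem hΓ.measurableSet
      ae_mem' := by
        filter_upwards [ae_restrict_mem hΓ.measurableSet.compl, ae_restrict_of_ae hν] with ξ h1 h2
        rw [← hcover] at h2
        exact h2.resolve_left h1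
      norm_c := hc
      eq_mul := fun z hz => ?_
      norm_le_one := hf1 }, hcard, fun x hx hxE => ?_, hnear, ?_, ?_⟩
  · have hint := integrable_herglotz_kernel (isCompact_sphere (0 : ℂ) 1) hν
      (not_mem_sphere_of_mem_ball hz)
    rw [hfν z hz, herglotzExp, herglotzExp, herglotzExp, ← Complex.exp_add, ← neg_add,
      herglotzIntegral, herglotzIntegral, herglotzIntegral,
      integral_add_compl hΓ.measurableSet hint]
  · have := hfar x hx x hxE
    rw [sub_self, norm_zero] at this
    exact absurd this (not_lt.2 (by positivity))
  · rw [measureReal_restrict_apply_univ]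
    refine measureReal_mono fun x hx => ?_
    obtain ⟨e, he, hxe⟩ := hnear x hx
    exact mem_cthickening_of_dist_le x e _ E he (by rwa [dist_eq_norm])
  · rw [measureReal_restrict_apply_univ, measureReal_restrict_apply_univ,
      measureReal_add_measureReal_compl hΓ.measurableSet]

/-! ### Approximate units inside the ideal, and the conclusion. -/

/-- The essential point is that the constant in the weighted bound is independent of `M`. Where
`d(ξ, E) ≤ 16 / M`, powers of `M` are traded for inverse powers of the distance; elsewhere `ξ` is
far from `Γ` and the kernel estimates apply. -/
theorem exists_mem_approximate_unit {f : LipAlgebra ω}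
    (hf1 : ∀ z ∈ closedBall (0 : ℂ) 1, ‖lipFun f z‖ ≤ 1) {ν : Measure ℂ} [IsFiniteMeasure ν]
    (hν : ∀ᵐ ξ ∂ν, ξ ∈ sphere (0 : ℂ) 1) {c : ℂ} (hc : ‖c‖ = 1)
    (hfν : ∀ z ∈ ball (0 : ℂ) 1, lipFun f z = c * herglotzExp ν z) {E : Set ℂ} (hE : IsClosed E)
    (hE1 : E ⊆ sphere 0 1) (hne : E.Nonempty) {K : Ideal (LipAlgebra ω)} (hfK : f ∈ K)
    (hK : ∀ w ∈ closedBall (0 : ℂ) 1, (∀ k ∈ K, lipFun k w = 0) → w ∈ E) {M : ℕ} (hM : 0 < M) :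
    ∃ V ∈ K, (∀ z ∈ closedBall (0 : ℂ) 1, ‖lipFun V z‖ ≤ 1) ∧
      (∀ ξ ∈ sphere (0 : ℂ) 1, ξ ∉ E → ∀ ζ ∈ sphere (0 : ℂ) 1, ‖lipFun V ξ - lipFun V ζ‖ ≤
        lipSeminorm f * ω ‖ξ - ζ‖ +
          (2 * ν.real univ + 4) * 8 ^ 6 * (‖ξ - ζ‖ / (infDist ξ E / 2) ^ 8)) ∧
      ∀ δ : ℝ, 16 / M ≤ δ → ∀ ξ ∈ sphere (0 : ℂ) 1, δ ≤ infDist ξ E →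
        ‖1 - lipFun V ξ‖ ≤ (2 * ν.real (cthickening (8 / M) E) + 2 / M) / (δ / 2) ∧
        ∀ ζ ∈ sphere (0 : ℂ) 1, δ ≤ infDist ζ E → ‖lipFun V ξ - lipFun V ζ‖ ≤
          (2 * ν.real (cthickening (8 / M) E) + 2 / M) / (δ / 2 * (δ / 2)) * ‖ξ - ζ‖ := by
  obtain ⟨P, hcard, hΓ', hΓ, hνΓ, hνsum⟩ := exists_outerSplitting hf1 hν hc hfν E hM
  have hM' : (0 : ℝ) < M := Nat.cast_pos.2 hM
  have hM1 : (1 : ℝ) ≤ M := Nat.one_le_cast.2 hM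
  -- This `ε` makes `S.card * ε ≤ 1 / M` small while `S.card / ε ≤ M ^ 3` stays polynomial in `M`.
  obtain ⟨ε, hε⟩ : ∃ ε : ℝ, ε = 1 / (M : ℝ) ^ 2 := ⟨_, rfl⟩
  have hε0 : 0 < ε := by rw [hε]; positivity
  have hcard' : (P.S.card : ℝ) ≤ M := by exact_mod_cast hcard
  have hΛ : P.S.card / ε ≤ (M : ℝ) ^ 3 := by
    rw [div_le_iff₀ hε0, hε]
    calc (P.S.card : ℝ) ≤ M := hcard'
      _ = _ := by field_simp
  have hcε : P.S.card * ε ≤ 1 / M := by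
    rw [hε]
    calc (P.S.card : ℝ) * (1 / (M : ℝ) ^ 2) ≤ (M : ℝ) * (1 / (M : ℝ) ^ 2) := by gcongr
      _ = 1 / (M : ℝ) := by field_simp
  have hM1' : 1 / (M : ℝ) ≤ 1 := by rw [div_le_one hM']; exact hM1
  obtain ⟨V, hVK, hV⟩ := P.exists_mem_lipFun_eq_dampedFactor hε0 hfK fun w hw h hwΓ' =>
    hΓ' w hwΓ' (hK w hw h)
  have hu0 : 0 ≤ P.ν'.real univ := measureReal_nonneg
  have hu1 : 0 ≤ P.ν.real univ := measureReal_nonneg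
  have hV1 : ∀ z ∈ closedBall (0 : ℂ) 1, ‖lipFun V z‖ ≤ 1 := fun z hz => by
    rw [hV z hz]; exact P.norm_dampedFactor_le_one hε0 hz
  have hdist : ∀ ξ : ℂ, ∀ δ : ℝ, 16 / M ≤ δ → δ ≤ infDist ξ E → ∀ γ ∈ P.Γ, δ / 2 ≤ ‖γ - ξ‖ := by
    intro ξ δ hδ hd γ hγ
    obtain ⟨e, he, hγe⟩ := hΓ γ hγ
    have h1 : infDist ξ E ≤ ‖ξ - e‖ := by
      rw [← dist_eq_norm]; exact infDist_le_dist_of_mem he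
    have h2 : ‖ξ - e‖ ≤ ‖γ - ξ‖ + ‖γ - e‖ := by
      calc ‖ξ - e‖ = ‖-(γ - ξ) + (γ - e)‖ := by congr 1; ring
        _ ≤ _ := (norm_add_le _ _).trans_eq (by rw [norm_neg])
    have h3 : (8 : ℝ) / M = (16 / M) / 2 := by ring
    linarith
  refine ⟨V, hVK, hV1, fun ξ hξ hξE ζ hζ => ?_, fun δ hδ ξ hξ hd => ⟨?_, fun ζ hζ hd' => ?_⟩⟩
  · have hξc := sphere_subset_closedBall hξ
    have hζc := sphere_subset_closedBall hζ
    have hω := mul_nonneg (lipSeminorm_nonneg f) (ω.nonneg_sphere hξ hζ)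
    have hd0 : 0 < infDist ξ E := (hE.notMem_iff_infDist_pos hne).1 hξE
    have hd2 := infDist_le_two_of_sphere hE1 hne hξ
    obtain ⟨s, hs⟩ : ∃ s, s = infDist ξ E / 2 := ⟨_, rfl⟩
    have hs0 : 0 < s := by rw [hs]; positivity
    have hs1 : s ≤ 1 := by rw [hs]; linarith
    set t := ‖ξ - ζ‖
    have ht0 : 0 ≤ t := norm_nonneg _
    rw [← hs, hV ξ hξc, hV ζ hζc]
    have hpow : ∀ k ≤ 8, t / s ^ k ≤ t / s ^ 8 := fun k hk => by
      have := pow_le_pow_of_le_one hs0.le hs1 hk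
      gcongr
    have hu : 0 ≤ ν.real univ := measureReal_nonneg
    have ht8 : 0 ≤ t / s ^ 8 := by positivity
    rcases le_or_gt (infDist ξ E) (16 / M) with hdM | hdM
    · have h1 := P.norm_dampedFactor_sub_le hε0 hΛ (by positivity) hξ hζ
      refine h1.trans (add_le_add le_rfl ?_)
      rw [hνsum]
      -- With `Λ = M ^ 3` the constant grows like `Λ ^ 2 = M ^ 6`, which this inequality converts
      -- into `(8 / s) ^ 6`.
      have hMs : (M : ℝ) ≤ 8 / s := by
        rw [le_div_iff₀ hs0, hs]
        rw [le_div_iff₀ hM'] at hdM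
        linarith
      have hM36 : (M : ℝ) ^ 3 ≤ (M : ℝ) ^ 6 := pow_le_pow_right₀ hM1 (by norm_num)
      calc (2 * ν.real univ * ((M : ℝ) ^ 3) ^ 2 + 2 * (M : ℝ) ^ 3) * t
          ≤ ((2 * ν.real univ + 4) * (M : ℝ) ^ 6) * t := by
            gcongr
            rw [← pow_mul]
            norm_num
            nlinarith [pow_pos hM' 6]
        _ ≤ ((2 * ν.real univ + 4) * (8 / s) ^ 6) * t := by gcongr
        _ = (2 * ν.real univ + 4) * 8 ^ 6 * (t / s ^ 6) := by rw [div_pow]; ring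
        _ ≤ _ := mul_le_mul_of_nonneg_left (hpow 6 (by norm_num)) (by positivity)
    · have hγξ : ∀ γ ∈ P.Γ, s ≤ ‖γ - ξ‖ := by
        rw [hs]; exact hdist ξ _ hdM.le le_rfl
      have h86 : (1 : ℝ) ≤ 8 ^ 6 := by norm_num
      -- If `t ≤ s / 2`, the point `ζ` is also far from `Γ`; otherwise the trivial bound `2 ≤ 4 * (t
      -- / s)` is enough.
      rcases le_or_gt t (s / 2) with ht | ht
      · have hγζ : ∀ γ ∈ P.Γ, s / 2 ≤ ‖γ - ζ‖ := fun γ hγ => by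
          have h1 : ‖γ - ξ‖ ≤ ‖γ - ζ‖ + t := by
            calc ‖γ - ξ‖ = ‖(γ - ζ) - (ξ - ζ)‖ := by congr 1; ring
              _ ≤ _ := _root_.norm_sub_le _ _
          linarith [hγξ γ hγ]
        have h1 := P.norm_dampedFactor_sub_le_of_dist hε0 hξc hζc hs0 (half_pos hs0) hγξ hγζ
        have h2 : (2 * P.ν.real univ + 2 * (P.S.card * ε)) * t / (s * (s / 2)) ≤
            (2 * ν.real univ + 4) * 8 ^ 6 * (t / s ^ 8) :=
          calc _ = (2 * P.ν.real univ + 2 * (P.S.card * ε)) * 2 * (t / s ^ 2) := by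
                field_simp
            _ ≤ (2 * ν.real univ + 4) * 8 ^ 6 * (t / s ^ 8) := by
                gcongr ?_ * ?_ * ?_
                · linarith
                · norm_num
                · exact hpow 2 (by norm_num)
        linarith
      · have h1 := _root_.norm_sub_le (P.dampedFactor ε ξ) (P.dampedFactor ε ζ)
        have h2 := P.norm_dampedFactor_le_one hε0 hξc
        have h3 := P.norm_dampedFactor_le_one hε0 hζc
        have h4 : 1 / 2 ≤ t / s := by rw [le_div_iff₀ hs0]; linarith
        have h5 := hpow 1 (by norm_num)
        rw [pow_one] at h5
        have h6 : 4 * (t / s ^ 8) ≤ (2 * ν.real univ + 4) * 8 ^ 6 * (t / s ^ 8) := by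
          gcongr
          linarith
        linarith
  · have hδ0 : 0 < δ := lt_of_lt_of_le (by positivity) hδ
    have hξc := sphere_subset_closedBall hξ
    rw [hV ξ hξc]
    refine (P.norm_one_sub_dampedFactor_le hε0 hξc (half_pos hδ0) (hdist ξ δ hδ hd)).trans ?_
    have : (2 : ℝ) / M = 2 * (1 / M) := by ring
    rw [this]
    gcongr
  · have hδ0 : 0 < δ := lt_of_lt_of_le (by positivity) hδ
    have hξc := sphere_subset_closedBall hξ
    have hζc := sphere_subset_closedBall hζ
    rw [hV ξ hξc, hV ζ hζc]
    refine (P.norm_dampedFactor_sub_le_of_dist hε0 hξc hζc (half_pos hδ0) (half_pos hδ0)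
      (hdist ξ δ hδ hd) (hdist ζ δ hδ hd')).trans ?_
    have : (2 : ℝ) / M = 2 * (1 / M) := by ring
    rw [this, div_mul_eq_mul_div (_ + _)]
    gcongr

theorem tendsto_measureReal_cthickening {ν : Measure ℂ} [IsFiniteMeasure ν] {E : Set ℂ}
    (hE : IsClosed E) (h0 : ν E = 0) :
    Tendsto (fun n : ℕ => 2 * ν.real (cthickening (8 / ((n + 1 : ℕ) : ℝ)) E) +
      2 / ((n + 1 : ℕ) : ℝ)) atTop (𝓝 0) := by
  have hdiv : ∀ a : ℝ, Tendsto (fun n : ℕ => a / ((n + 1 : ℕ) : ℝ)) atTop (𝓝 0) := fun a =>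
    (tendsto_const_div_atTop_nhds_zero_nat a).comp (tendsto_add_atTop_nat 1)
  have h1 := (tendsto_measure_cthickening_of_isClosed (μ := ν) (s := E)
    ⟨1, one_pos, measure_ne_top _ _⟩ hE).comp (hdiv 8)
  rw [h0] at h1
  have h2 := (ENNReal.tendsto_toReal ENNReal.zero_ne_top).comp h1
  have h3 := (h2.const_mul 2).add (hdiv 2)
  simpa [Function.comp_def, measureReal_def] using h3

theorem mem_of_mul_outer_mem (hω : 0 < ω.eta) {I : Ideal (LipAlgebra ω)} (hI : IsNormClosed I)
    {g : LipAlgebra ω} (hg : g ∈ smallSpace ω (hull I)) {f : LipAlgebra ω} (hgf : g * f ∈ I)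
    (hf1 : ∀ z ∈ closedBall (0 : ℂ) 1, ‖lipFun f z‖ ≤ 1) {ν : Measure ℂ} [IsFiniteMeasure ν]
    (hν : ν ≪ arcMeasure) {c : ℂ} (hc : ‖c‖ = 1)
    (hfν : ∀ z ∈ ball (0 : ℂ) 1, lipFun f z = c * herglotzExp ν z) : g ∈ I := by
  let K : Ideal (LipAlgebra ω) := Submodule.comap (LinearMap.lsmul (LipAlgebra ω) _ g) I
  have hKI : ∀ h, h ∈ K ↔ g * h ∈ I := fun h => Iff.rfl
  have hE := isClosed_hull I
  have hE1 : hull I ⊆ sphere 0 1 := fun ξ hξ => hξ.1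
  have hfK : f ∈ K := hgf
  -- Inside the disc `f ∈ K` has no zeros, and on the circle `I ⊆ K` confines common zeros to the
  -- hull.
  have hK : ∀ w ∈ closedBall (0 : ℂ) 1, (∀ k ∈ K, lipFun k w = 0) → w ∈ hull I := by
    intro w hw h
    refine ⟨?_, fun k hk => h k ((hKI k).2 (I.mul_mem_left g hk))⟩
    rw [mem_sphere_zero_iff_norm]
    refine le_antisymm (mem_closedBall_zero_iff.1 hw) ?_
    by_contra! hlt
    have h1 := h f hfK
    rw [hfν w (mem_ball_zero_iff.2 hlt)] at h1
    refine mul_ne_zero (norm_pos_iff.1 ?_) (herglotzExp_ne_zero ν w) h1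
    rw [hc]; exact one_pos
  -- The empty hull is treated apart, since `infDist` to the empty set is `0` by convention.
  rcases (hull I).eq_empty_or_nonempty with hempty | hne
  · have h1 : (1 : LipAlgebra ω) ∈ K :=
      mem_of_mul_mem_of_forall_ne_zero (v := f) (by rwa [one_mul]) fun w hw h => by
        have := hK w hw h
        rw [hempty] at this
        exact this.elim
    simpa using (hKI 1).1 h1
  by_cases hpos : arcMeasure (hull I) = 0
  swap
  · have h0 : ∀ z ∈ ball (0 : ℂ) 1, lipFun g z = 0 := fun z hz =>
      eq_zero_of_eqOn_zero_of_arcMeasure_pos hE hE1 (pos_iff_ne_zero.2 hpos)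
        (diffContOnCl_lipFun g) hg.1 hz
    have hg0 : g = 0 := ext_lipFun fun z hz => by
      rw [lipFun_zero, ← norm_le_zero_iff]
      exact (norm_lipFun_le g hz).trans (supNorm_le fun w hw => by rw [h0 w hw, norm_zero])
    rw [hg0]
    exact I.zero_mem
  -- Absolute continuity enters here: it makes the mass of `ν` near the hull tend to `0`.
  have hνE : ν (hull I) = 0 := hν hpos
  have hνs : ∀ᵐ ξ ∂ν, ξ ∈ sphere (0 : ℂ) 1 := hν.ae_le ae_mem_sphere_arcMeasure
  choose V hVK hV1 hVC hVlim using fun n : ℕ =>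
    exists_mem_approximate_unit hf1 hνs hc hfν hE hE1 hne hfK hK (Nat.succ_pos n)
  have hω2 : 0 < ω 2 := ω.pos two_pos le_rfl
  have hL := lipSeminorm_nonneg f
  obtain ⟨C, hC⟩ : ∃ C, C = (2 * ν.real univ + 4) * 8 ^ 6 := ⟨_, rfl⟩
  have hC0 : 0 ≤ C := by rw [hC]; positivity
  refine mem_of_approximate_unit hI hE hE1 hne hg (V := V) (fun n => (hKI _).1 (hVK n)) hV1
    (C := lipSeminorm f * ω 2 + (4 + 2 * C) / ω.eta ^ 3) (by positivity) ?_ ?_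
  · intro n ξ hξ hξE ζ hζ
    have hd0 : 0 < infDist ξ (hull I) := (hE.notMem_iff_infDist_pos hne).1 hξE
    have hd2 := infDist_le_two_of_sphere hE1 hne hξ
    have h1 := hVC n ξ hξ hξE ζ hζ
    rw [← hC] at h1
    have h2 : ‖lipFun (V n) ξ - lipFun (V n) ζ‖ ≤ 2 := by
      have a1 := hV1 n ξ (sphere_subset_closedBall hξ)
      have a2 := hV1 n ζ (sphere_subset_closedBall hζ)
      linarith [_root_.norm_sub_le (lipFun (V n) ξ) (lipFun (V n) ζ)]
    -- Applied with `s` equal to half the distance, so that `s ≤ 1` and `ω (2 * s)` is the weight at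
    -- the distance itself.
    have := ω.mul_le_of_le_two hω (half_pos hd0) (by linarith) (norm_nonneg (ξ - ζ))
      (norm_sub_le_two_of_sphere hξ hζ) hL hC0 h2 h1
    rwa [mul_div_cancel₀ _ two_ne_zero] at this
  · intro δ hδ τ hτ
    have hlim := tendsto_measureReal_cthickening hE hνE
    have e1 : ∀ᶠ n : ℕ in atTop, (16 : ℝ) / ((n + 1 : ℕ) : ℝ) ≤ δ := by
      have := (tendsto_const_div_atTop_nhds_zero_nat (16 : ℝ)).comp (tendsto_add_atTop_nat 1)
      exact this.eventually (eventually_le_nhds hδ)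
    have e2 := (hlim.div_const (δ / 2)).eventually
      (eventually_le_nhds (a := 0 / (δ / 2)) (b := τ) (by rwa [zero_div]))
    have e3 := (hlim.div_const (δ / 2 * (δ / 2))).eventually
      (eventually_le_nhds (a := 0 / (δ / 2 * (δ / 2))) (b := τ * (ω 2 / 2))
        (by rw [zero_div]; positivity))
    filter_upwards [e1, e2, e3] with n h1 h2 h3 ξ hξ hd
    obtain ⟨a1, a2⟩ := hVlim n δ h1 ξ hξ hd
    refine ⟨a1.trans h2, fun ζ hζ hd' => (a2 ζ hζ hd').trans ?_⟩
    have h4 := ω.mul_le (norm_nonneg (ξ - ζ)) (norm_sub_le_two_of_sphere hξ hζ)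
    calc _ ≤ τ * (ω 2 / 2) * ‖ξ - ζ‖ := mul_le_mul_of_nonneg_right h3 (norm_nonneg _)
      _ = τ * (ω 2 / 2 * ‖ξ - ζ‖) := by ring
      _ ≤ _ := by gcongr

end LipAlgebra

theorem proposition1 (ω : ModulusOfContinuity) (hω : 0 < ω.eta)
    (I : Ideal (LipAlgebra ω)) (hI : LipAlgebra.IsNormClosed I)
    (g : LipAlgebra ω) (hg : g ∈ LipAlgebra.smallSpace ω (LipAlgebra.hull I))
    (f : LipAlgebra ω) (hf : LipAlgebra.IsOuter f) (hgf : g * f ∈ I) :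
    g ∈ I := by
  -- Dividing by `R` brings `f` into the unit ball; `R ≥ 1` is what `IsOuter.exists_measure` needs
  -- for a nonnegative density.
  set R := max 1 (LipAlgebra.supNorm f)
  have hR1 : 1 ≤ R := le_max_left _ _
  have hR0 : 0 < R := one_pos.trans_le hR1
  have hfR : ∀ z ∈ closedBall (0 : ℂ) 1, ‖lipFun f z‖ ≤ R := fun z hz =>
    (LipAlgebra.norm_lipFun_le f hz).trans (le_max_right _ _)
  obtain ⟨ν, hfin, hν, c, hc, h⟩ := hf.exists_measure hR1 hfR
  have hf' : ∀ z ∈ closedBall (0 : ℂ) 1,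
      lipFun (algebraMap ℂ (LipAlgebra ω) (R : ℂ)⁻¹ * f) z = (R : ℂ)⁻¹ * lipFun f z := fun z hz => by
    rw [LipAlgebra.lipFun_mul, LipAlgebra.lipFun_algebraMap _ hz]
  have hRc : (R : ℂ) ≠ 0 := Complex.ofReal_ne_zero.2 hR0.ne'
  refine LipAlgebra.mem_of_mul_outer_mem hω hI hg
    (f := algebraMap ℂ (LipAlgebra ω) (R : ℂ)⁻¹ * f) ?_ (fun z hz => ?_) hν hc fun z hz => ?_
  · rw [mul_left_comm]
    exact I.mul_mem_left _ hgf
  · rw [hf' z hz, norm_mul, norm_inv, Complex.norm_of_nonneg hR0.le, inv_mul_le_one₀ hR0]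
    exact hfR z hz
  · rw [hf' z (ball_subset_closedBall hz), h z hz]
    field_simp
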